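/- Let $a<b$, let $k\in L^2((a,b)^2)$ be real-valued, and let $K:L^2(a,b)\to L^2(a,b)$, $(Kx)(s)=\int_a^b k(s,t)x(t)\,dt$. Assume that the range of $K$ is contained in the Sobolev space $H^m(a,b)$ for some integer $m\ge 1$; point values of functions in the range are those of the representative that is continuous on $[a,b]$. Write $\|\cdot\|$ for the norm of $L^2(a,b)$ and $N(K)$ for the null space of $K$. Let $(s_j;\phi_j,\psi_j)_j$ be a singular system of $K$: $s_j>0$, $(\phi_j)$ and $(\psi_j)$ are orthonormal, $K\phi_j=s_j\psi_j$, $K^*\psi_j=s_j\phi_j$, and the closed span of $(\phi_j)$ is $N(K)^\perp$. Let $$W=\Bigl\{f\in N(K)^\perp:\ \|f\|_W^2:=\sum_j \frac{(f,\phi_j)^2}{s_j}<\infty\Bigr\},\qquad \|u\|_{W^*}=\sup_{0\ne v\in W}\frac{|(u,v)_{L^2}|}{\|v\|_W}.$$ Let $y$ be in the range of $K$ and let $x^\dagger$ be the best-approximate solution of $Kx=y$ (the least-squares solution of minimal norm); assume $x^\dagger\neq 0$. For $n\ge 1$ let $a\le \tau_1<\dots<\tau_n\le b$ be sampling points that are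 quasi-uniform with constant $B$, that is, $h\le B\,|\tau_i-\tau_j|$ for all $i\ne j$, where $h=\max_{\tau\in[a,b]}\min_i|\tau-\tau_i|$. Let $e_1,\dots,e_n$ be independent square-integrable random variables with $\mathbb E[e_i]=0$ and $\operatorname{Var}[e_i]\le\sigma^2$, where $\sigma>0$, let $w_i=y(\tau_i)+e_i$, and for $\alpha>0$ let $x_{n,\alpha}$ be the minimizer over $x\in L^2(a,b)$ of $$\frac1n\sum_{i=1}^n\bigl((Kx)(\tau_i)-w_i\bigr)^2+\alpha\|x\|^2 .$$ Suppose that $\alpha$ is chosen by the a priori rule that $\alpha^{\frac12+\frac1{4m}}$ is of the order of $\sigma n^{-1/2}\|x^\dagger\|^{-1}$, i.e., for some constants $c_1>0$ and $c_2$, $$c_1\,\sigma n^{-1/2}\|x^\dagger\|^{-1}\ \le\ \alpha^{\frac12+\frac1{4m}}\ \le\ c_2\,\sigma n^{-1/2}\|x^\dagger\|^{-1}.$$ Then $$\mathbb E\bigl[\|x_{n,\alpha}-x^\dagger\|_{W^*}^2\bigr]\ \le\ C\,\bigl(\sigma n^{-1/2}\bigr)^{\frac{2m}{1+2m}}\,\|x^\dagger\|^{\frac{2+2m}{1+2m}}$$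 (in particular the expectation is finite) whenever $\alpha\ge h^{2m}$, and also, without this last requirement, for all $n\ge N$. Here $C>0$ depends only on $a,b,k,m,B,c_1,c_2$, and $N$ may depend in addition on $\sigma$ and $y$, but neither $C$ nor $N$ depends on the sampling points, on $\alpha$, or on the probability space and the distribution of the noise. -/

import Mathlib

open MeasureTheory ProbabilityTheory Set
open scoped ENNReal

noncomputable section

namespace Fredholm

/-- Lebesgue measure on the open interval `(a, b)`. -/
abbrev intervalVol (a b : ℝ) : Measure ℝ := volume.restrict (Ioo a b)

/-- The real Hilbert space `L²(a, b)`. -/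
abbrev L2 (a b : ℝ) : Type := Lp ℝ 2 (intervalVol a b)

/-! ### The integral operator -/

section Operator

variable {a b : ℝ} {k : ℝ × ℝ → ℝ}

/-- The function `s ↦ ∫_a^b k(s,t) x(t) dt`. -/
def kernelInt (a b : ℝ) (k : ℝ × ℝ → ℝ) (x : ℝ → ℝ) (s : ℝ) : ℝ :=
  ∫ t, k (s, t) * x t ∂(intervalVol a b)

theorem eLpNorm_two_sq {μ : Measure ℝ} (f : ℝ → ℝ) :
    (∫⁻ t, ‖f t‖ₑ ^ (2 : ℝ) ∂μ) ^ (1 / 2 : ℝ) = eLpNorm f 2 μ := by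
  rw [eLpNorm_eq_lintegral_rpow_enorm_toReal (by norm_num) (by norm_num)]
  simp

theorem aestronglyMeasurable_kernelInt
    (hk : MemLp k 2 ((intervalVol a b).prod (intervalVol a b)))
    {x : ℝ → ℝ} (hx : MemLp x 2 (intervalVol a b)) :
    AEStronglyMeasurable (kernelInt a b k x) (intervalVol a b) := by
  have h : AEStronglyMeasurable (fun p : ℝ × ℝ => k p * x p.2)
      ((intervalVol a b).prod (intervalVol a b)) :=
    hk.1.mul hx.1.comp_snd
  exact h.integral_prod_right'

theorem lintegral_kernel_mul_le
    (hk : MemLp k 2 ((intervalVol a b).prod (intervalVol a b)))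
    {x : ℝ → ℝ} (hx : MemLp x 2 (intervalVol a b)) :
    ∀ᵐ s ∂(intervalVol a b), ∫⁻ t, ‖k (s, t) * x t‖ₑ ∂(intervalVol a b) ≤
      (∫⁻ t, ‖k (s, t)‖ₑ ^ (2 : ℝ) ∂(intervalVol a b)) ^ (1 / 2 : ℝ) *
        eLpNorm x 2 (intervalVol a b) := by
  filter_upwards [hk.1.prodMk_left] with s hs
  rw [← eLpNorm_two_sq]
  simp only [enorm_mul]
  exact ENNReal.lintegral_mul_le_Lp_mul_Lq _ Real.HolderConjugate.two_two
    hs.enorm hx.1.enorm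

theorem lintegral_kernel_sq (hk : MemLp k 2 ((intervalVol a b).prod (intervalVol a b))) :
    (∫⁻ s, ∫⁻ t, ‖k (s, t)‖ₑ ^ (2 : ℝ) ∂(intervalVol a b) ∂(intervalVol a b)) =
      eLpNorm k 2 ((intervalVol a b).prod (intervalVol a b)) ^ (2 : ℝ) := by
  rw [eLpNorm_eq_lintegral_rpow_enorm_toReal (by norm_num) (by norm_num),
    lintegral_prod _ (hk.1.enorm.pow_const _)]
  rw [← ENNReal.rpow_mul]
  norm_num

theorem integrable_kernel_mul
    (hk : MemLp k 2 ((intervalVol a b).prod (intervalVol a b)))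
    {x : ℝ → ℝ} (hx : MemLp x 2 (intervalVol a b)) :
    ∀ᵐ s ∂(intervalVol a b), Integrable (fun t => k (s, t) * x t) (intervalVol a b) := by
  have hfin : ∀ᵐ s ∂(intervalVol a b),
      ∫⁻ t, ‖k (s, t)‖ₑ ^ (2 : ℝ) ∂(intervalVol a b) < ∞ := by
    refine ae_lt_top' (AEMeasurable.lintegral_prod_right' (hk.1.enorm.pow_const _)) ?_
    rw [lintegral_kernel_sq hk]
    exact ENNReal.rpow_ne_top_of_nonneg (by norm_num) hk.2.ne
  filter_upwards [hk.1.prodMk_left, lintegral_kernel_mul_le hk hx, hfin] with s hs h1 h2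
  refine ⟨hs.mul hx.1, lt_of_le_of_lt h1 ?_⟩
  exact ENNReal.mul_lt_top (ENNReal.rpow_lt_top_of_nonneg (by norm_num) h2.ne) hx.2

theorem eLpNorm_kernelInt_le
    (hk : MemLp k 2 ((intervalVol a b).prod (intervalVol a b)))
    {x : ℝ → ℝ} (hx : MemLp x 2 (intervalVol a b)) :
    eLpNorm (kernelInt a b k x) 2 (intervalVol a b) ≤
      eLpNorm k 2 ((intervalVol a b).prod (intervalVol a b)) *
        eLpNorm x 2 (intervalVol a b) := by
  rw [← eLpNorm_two_sq (kernelInt a b k x)]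
  calc (∫⁻ s, ‖kernelInt a b k x s‖ₑ ^ (2 : ℝ) ∂(intervalVol a b)) ^ (1 / 2 : ℝ)
      ≤ (∫⁻ s, (∫⁻ t, ‖k (s, t)‖ₑ ^ (2 : ℝ) ∂(intervalVol a b)) *
          eLpNorm x 2 (intervalVol a b) ^ (2 : ℝ) ∂(intervalVol a b)) ^ (1 / 2 : ℝ) := by
        refine ENNReal.rpow_le_rpow (lintegral_mono_ae ?_) (by norm_num)
        filter_upwards [lintegral_kernel_mul_le hk hx] with s hs
        calc ‖kernelInt a b k x s‖ₑ ^ (2 : ℝ)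
            ≤ ((∫⁻ t, ‖k (s, t)‖ₑ ^ (2 : ℝ) ∂(intervalVol a b)) ^ (1 / 2 : ℝ) *
                eLpNorm x 2 (intervalVol a b)) ^ (2 : ℝ) :=
              ENNReal.rpow_le_rpow ((enorm_integral_le_lintegral_enorm _).trans hs)
                (by norm_num)
          _ = _ := by
              rw [ENNReal.mul_rpow_of_nonneg _ _ (by norm_num), ← ENNReal.rpow_mul]
              norm_num
    _ = _ := by
        rw [lintegral_mul_const'' _
          (AEMeasurable.lintegral_prod_right' (hk.1.enorm.pow_const _)),
          lintegral_kernel_sq hk, ENNReal.mul_rpow_of_nonneg _ _ (by norm_num),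
          ← ENNReal.rpow_mul, ← ENNReal.rpow_mul]
        norm_num

theorem memLp_kernelInt
    (hk : MemLp k 2 ((intervalVol a b).prod (intervalVol a b)))
    {x : ℝ → ℝ} (hx : MemLp x 2 (intervalVol a b)) :
    MemLp (kernelInt a b k x) 2 (intervalVol a b) :=
  ⟨aestronglyMeasurable_kernelInt hk hx,
    (eLpNorm_kernelInt_le hk hx).trans_lt (ENNReal.mul_lt_top hk.2 hx.2)⟩

/-- The Fredholm integral operator `K : L²(a,b) → L²(a,b)`,
`(K x)(s) = ∫_a^b k(s,t) x(t) dt`, of a square integrable kernel `k`. -/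
def integralOp (a b : ℝ) (k : ℝ × ℝ → ℝ)
    (hk : MemLp k 2 ((intervalVol a b).prod (intervalVol a b))) :
    L2 a b →L[ℝ] L2 a b :=
  LinearMap.mkContinuous
    { toFun := fun x => (memLp_kernelInt hk (Lp.memLp x)).toLp (kernelInt a b k x)
      map_add' := by
        intro x y
        rw [← MemLp.toLp_add]
        refine MemLp.toLp_congr _ _ ?_
        filter_upwards [integrable_kernel_mul hk (Lp.memLp x),
          integrable_kernel_mul hk (Lp.memLp y)] with s hx hy
        simp only [kernelInt, Pi.add_apply]
        rw [← integral_add hx hy]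
        refine integral_congr_ae ?_
        filter_upwards [Lp.coeFn_add x y] with t ht
        rw [ht, Pi.add_apply, mul_add]
      map_smul' := by
        intro c x
        rw [RingHom.id_apply, ← MemLp.toLp_const_smul]
        refine MemLp.toLp_congr _ _ (Filter.Eventually.of_forall fun s => ?_)
        simp only [kernelInt, Pi.smul_apply, smul_eq_mul]
        rw [← integral_const_mul]
        refine integral_congr_ae ?_
        filter_upwards [Lp.coeFn_smul c x] with t ht
        rw [ht, Pi.smul_apply, smul_eq_mul]
        ring }
    (eLpNorm k 2 ((intervalVol a b).prod (intervalVol a b))).toReal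
    (by
      intro x
      simp only [LinearMap.coe_mk, AddHom.coe_mk, Lp.norm_toLp]
      rw [Lp.norm_def, ← ENNReal.toReal_mul]
      exact ENNReal.toReal_mono (ENNReal.mul_lt_top hk.2 (Lp.memLp x).2).ne
        (eLpNorm_kernelInt_le hk (Lp.memLp x)))

theorem integralOp_coeFn
    (hk : MemLp k 2 ((intervalVol a b).prod (intervalVol a b))) (x : L2 a b) :
    integralOp a b k hk x =ᵐ[intervalVol a b]
      fun s => ∫ t, k (s, t) * x t ∂(intervalVol a b) :=
  MemLp.coeFn_toLp (memLp_kernelInt hk (Lp.memLp x))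

end Operator

/-! ### The Sobolev space `H^m(a, b)` and point values -/

/-- `g` is the weak derivative of order `j` of `f` on `(a, b)`. -/
def IsWeakDeriv (a b : ℝ) (j : ℕ) (f g : L2 a b) : Prop :=
  ∀ η : ℝ → ℝ, ContDiff ℝ (⊤ : ℕ∞) η → HasCompactSupport η → tsupport η ⊆ Ioo a b →
    ∫ t, f t * iteratedDeriv j η t ∂(intervalVol a b) =
      (-1) ^ j * ∫ t, g t * η t ∂(intervalVol a b)

/-- `f ∈ H^m(a, b)`: all weak derivatives of `f` up to order `m` exist and lie in `L²(a, b)`. -/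
def MemSobolev (a b : ℝ) (m : ℕ) (f : L2 a b) : Prop :=
  ∀ j ≤ m, ∃ g : L2 a b, IsWeakDeriv a b j f g

open Classical in
/-- The representative of `f ∈ L²(a, b)` that is continuous on `[a, b]`, if there is one. For
`a < b` its values on `[a, b]` are unique, and it exists for `f ∈ H^m(a, b)`, `m ≥ 1`. It gives the
meaning of the point values `f(s)`, `s ∈ [a, b]`. -/
def contRep {a b : ℝ} (f : L2 a b) : ℝ → ℝ :=
  if h : ∃ g : ℝ → ℝ, ContinuousOn g (Icc a b) ∧ f =ᵐ[intervalVol a b] g then h.choose else 0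

/-! ### Sampling points -/

/-- The fill distance `h_max = max_{x ∈ [a,b]} min_i |x - s_i|`. -/
def fillDist (a b : ℝ) {n : ℕ} (s : Fin n → ℝ) : ℝ :=
  ⨆ x : Icc a b, ⨅ i : Fin n, |(x : ℝ) - s i|

/-- The points `a ≤ s_1 < ⋯ < s_n ≤ b` are quasi-uniform with constant `B`:
`h_max ≤ B h_min` where `h_min = min_{i ≠ j} |s_i - s_j|`. -/
structure IsQuasiUniform (a b B : ℝ) {n : ℕ} (s : Fin n → ℝ) : Prop where
  strictMono : StrictMono s
  mem_Icc : ∀ i, s i ∈ Icc a b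
  fillDist_le : ∀ i j, i ≠ j → fillDist a b s ≤ B * |s i - s j|

/-! ### Best-approximate and regularized solutions -/

/-- `x` is the best-approximate solution of `K x = y`: the element of least norm among all
least-squares solutions. -/
def IsBestApproxSol {a b : ℝ} (K : L2 a b →L[ℝ] L2 a b) (y x : L2 a b) : Prop :=
  (∀ z, ‖K x - y‖ ≤ ‖K z - y‖) ∧
    ∀ x', (∀ z, ‖K x' - y‖ ≤ ‖K z - y‖) → ‖x‖ ≤ ‖x'‖

/-- The functional `|K x - w|_n² + α ‖x‖²`, with `|u|_n² = (1/n) ∑ u(s_i)²`. -/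
def tikhonov {a b : ℝ} (K : L2 a b →L[ℝ] L2 a b) {n : ℕ} (s : Fin n → ℝ) (w : Fin n → ℝ)
    (α : ℝ) (x : L2 a b) : ℝ :=
  (1 / (n : ℝ)) * ∑ i, (contRep (K x) (s i) - w i) ^ 2 + α * ‖x‖ ^ 2

/-- The regularized solution `x_{n,α}`: the minimizer of the functional `tikhonov` over
`L²(a, b)`. -/
def regSol {a b : ℝ} (K : L2 a b →L[ℝ] L2 a b) {n : ℕ} (s : Fin n → ℝ) (w : Fin n → ℝ)
    (α : ℝ) : L2 a b :=
  Classical.epsilon fun x => ∀ z, tikhonov K s w α x ≤ tikhonov K s w α z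

/-! ### Singular systems, the space `W` and the dual norm -/

/-- `(sv_j; φ_j, ψ_j)` is a singular system of `K`. The index set is arbitrary, so that operators of
finite rank are included. -/
structure IsSingularSystem {a b : ℝ} (K : L2 a b →L[ℝ] L2 a b) {ι : Type*}
    (sv : ι → ℝ) (φ ψ : ι → L2 a b) : Prop where
  pos : ∀ j, 0 < sv j
  orthonormal_left : Orthonormal ℝ φ
  orthonormal_right : Orthonormal ℝ ψ
  map_left : ∀ j, K (φ j) = sv j • ψ j
  adjoint_map_right : ∀ j, ContinuousLinearMap.adjoint K (ψ j) = sv j • φ j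
  complete : (Submodule.span ℝ (range φ)).topologicalClosure = (LinearMap.ker K.toLinearMap)ᗮ

/-- The space `W = {f ∈ N(K)^⊥ : ∑ f_j² / s_j < ∞}`, `f_j = (f, φ_j)`. -/
def spaceW {a b : ℝ} (K : L2 a b →L[ℝ] L2 a b) {ι : Type*} (sv : ι → ℝ) (φ : ι → L2 a b) :
    Set (L2 a b) :=
  {f | f ∈ (LinearMap.ker K.toLinearMap)ᗮ ∧ Summable fun j => inner ℝ f (φ j) ^ 2 / sv j}

/-- The norm `‖f‖_W = (∑ f_j² / s_j)^{1/2}`. -/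
def normW {a b : ℝ} {ι : Type*} (sv : ι → ℝ) (φ : ι → L2 a b) (f : L2 a b) : ℝ :=
  Real.sqrt (∑' j, inner ℝ f (φ j) ^ 2 / sv j)

/-- The dual norm `‖u‖_{W*} = sup_{0 ≠ v ∈ W} |(u, v)| / ‖v‖_W` with respect to the `L²` pairing. -/
def normWDual {a b : ℝ} (K : L2 a b →L[ℝ] L2 a b) {ι : Type*} (sv : ι → ℝ) (φ : ι → L2 a b)
    (u : L2 a b) : ℝ :=
  sSup {r | ∃ v ∈ spaceW K sv φ, v ≠ 0 ∧ r = |inner ℝ u v| / normW sv φ v}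

end Fredholm

end

namespace Fredholm

/-! ### Ridge regression in a Hilbert space -/

section Ridge

set_option linter.unusedSectionVars false

variable {H G : Type*} [NormedAddCommGroup H] [InnerProductSpace ℝ H] [CompleteSpace H]
  [NormedAddCommGroup G] [InnerProductSpace ℝ G] [FiniteDimensional ℝ G] [CompleteSpace G]

/-! Put d = x_{n,α} − x† and |u|_n² = (1/n) ∑ u(τ_i)². The proof bounds the expectation of the
energy |Kd|_n² + α‖d‖² and converts it to the dual norm.

Conversion. Cauchy–Schwarz in the singular system gives ‖d‖_{W*}² ≤ ‖Kd‖ ‖d‖ (`normWDual_sq_le`). If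
‖Kd‖² is bounded by the energy, then ‖d‖_{W*}² is at most a constant times α^{-1/2} times the energy
(`normWDual_sq_le_energy`). The required bound is the sampling inequality `exists_sampling_bound`.
By the closed graph theorem the m-th weak derivative of Kx is Dx with D bounded. On a cell of length
comparable to h, Kx is a polynomial of degree < m, controlled by m sampled values, plus an m-fold
integral of Dx. The remainders add up to O(h^{2m}‖x‖²), which α‖x‖² absorbs when h^{2m} ≤ α.

Energy. The minimization is ridge regression for the sampling operator T into ℝⁿ. In `ridge_error`
the noise is split along a subspace F of ℝⁿ: the part in F costs dim F, the rest costs 2/(nα) times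
a squared Hilbert–Schmidt norm of T modulo F. Take for F the sampled piecewise polynomials on about
α^{-1/(2m)} cells. Modulo F only integral remainders over short cells are left, and both costs are
O(α^{-1/(2m)}) (`exists_effective_dimension_bound`). Decay of singular values is never used.

Hence the expected energy is O(σ² n^{-1} α^{-1/(2m)} + α‖x†‖²). The lower half of the parameter rule
makes the second term dominate, and the upper half turns α^{1/2}‖x†‖² into the stated rate. For
large n, quasi-uniformity gives h = O(1/n), and the rule then forces h^{2m} ≤ α
(`exists_fillDist_pow_le`). -/

theorem exists_ridge (T : H →L[ℝ] G) {β : ℝ} (hβ : 0 < β) :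
    ∃ R : G →L[ℝ] H, ∀ w, T.adjoint (T (R w) - w) + β • R w = 0 := by
  -- The solution is T*(TT* + β)⁻¹w, so only an injective operator on the finite-dimensional space G
  -- has to be inverted.
  let A : G →ₗ[ℝ] G := (T ∘L T.adjoint).toLinearMap + β • LinearMap.id
  have hA : ∀ v, A v = T (T.adjoint v) + β • v := fun v => by simp [A]
  have hinj : Function.Injective A := by
    rw [← LinearMap.ker_eq_bot, LinearMap.ker_eq_bot']
    intro v hv
    have h1 : inner ℝ (A v) v = ‖T.adjoint v‖ ^ 2 + β * ‖v‖ ^ 2 := by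
      rw [hA, inner_add_left, inner_smul_left, ← ContinuousLinearMap.adjoint_inner_right,
        real_inner_self_eq_norm_sq, real_inner_self_eq_norm_sq]
      simp
    rw [hv, inner_zero_left] at h1
    have h2 : β * ‖v‖ ^ 2 = 0 := by
      have := sq_nonneg ‖T.adjoint v‖
      have : 0 ≤ β * ‖v‖ ^ 2 := by positivity
      linarith
    simpa [hβ.ne'] using h2
  let e := LinearEquiv.ofInjectiveEndo A hinj
  refine ⟨T.adjoint ∘L LinearMap.toContinuousLinearMap e.symm.toLinearMap, fun w => ?_⟩
  have h : T (T.adjoint (e.symm w)) + β • e.symm w = w := by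
    rw [← hA]
    exact e.apply_symm_apply w
  have h' : T (T.adjoint (e.symm w)) - w = -(β • e.symm w) := by
    nth_rewrite 2 [← h]
    abel
  simp only [ContinuousLinearMap.comp_apply, LinearMap.coe_toContinuousLinearMap',
    LinearEquiv.coe_coe, h', map_neg, map_smul]
  abel

/-- Completing the square: the normal equation cancels the term linear in z − x. The remaining
quadratic gap yields both minimality and uniqueness. -/
theorem ridge_functional_eq (T : H →L[ℝ] G) {β : ℝ} {w : G} {x : H}
    (hx : T.adjoint (T x - w) + β • x = 0) (z : H) :
    ‖T z - w‖ ^ 2 + β * ‖z‖ ^ 2 =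
      ‖T x - w‖ ^ 2 + β * ‖x‖ ^ 2 + (‖T (z - x)‖ ^ 2 + β * ‖z - x‖ ^ 2) := by
  have h0 : inner ℝ (T x - w) (T (z - x)) + β * inner ℝ x (z - x) = 0 := by
    rw [← ContinuousLinearMap.adjoint_inner_left]
    have := congrArg (fun v => inner ℝ v (z - x)) hx
    simpa [inner_add_left, inner_smul_left] using this
  have h1 : T z - w = (T x - w) + T (z - x) := by rw [map_sub]; abel
  have h2 : z = x + (z - x) := by abel
  have h3 : ‖z‖ ^ 2 = ‖x‖ ^ 2 + 2 * inner ℝ x (z - x) + ‖z - x‖ ^ 2 := by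
    rw [← norm_add_sq_real, ← h2]
  rw [h1, norm_add_sq_real, h3]
  linear_combination 2 * h0

theorem ridge_minimizer_unique (T : H →L[ℝ] G) {β : ℝ} (hβ : 0 < β) {w : G} {x x' : H}
    (hx : T.adjoint (T x - w) + β • x = 0)
    (hx' : ∀ z, ‖T x' - w‖ ^ 2 + β * ‖x'‖ ^ 2 ≤ ‖T z - w‖ ^ 2 + β * ‖z‖ ^ 2) : x' = x := by
  have h1 := ridge_functional_eq T hx x'
  have h2 := hx' x
  have h3 : β * ‖x' - x‖ ^ 2 ≤ 0 := by
    have := sq_nonneg ‖T (x' - x)‖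
    linarith
  have h4 : ‖x' - x‖ ^ 2 ≤ 0 := by
    by_contra h
    push Not at h
    have : 0 < β * ‖x' - x‖ ^ 2 := mul_pos hβ h
    linarith
  have h5 : ‖x' - x‖ = 0 := by
    have := sq_nonneg ‖x' - x‖
    exact pow_eq_zero_iff (two_ne_zero) |>.1 (le_antisymm h4 this)
  exact sub_eq_zero.1 (norm_eq_zero.1 h5)

/-- Testing the normal equation with d = x − x₀ gives ‖Td‖² + β‖d‖² = (e, Td) − β(x₀, d). The part
of e in F is paired with Td; the part orthogonal to F is moved through T* and paired with d. The
subspace F is free, so that the two costs can be balanced later. -/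
theorem ridge_error (T : H →L[ℝ] G) (F : Submodule ℝ G) {β : ℝ} (hβ : 0 < β) {x x₀ : H} {e : G}
    (hx : T.adjoint (T x - (T x₀ + e)) + β • x = 0) :
    ‖T (x - x₀)‖ ^ 2 + β * ‖x - x₀‖ ^ 2 ≤ ‖F.starProjection e‖ ^ 2 +
      2 / β * ‖T.adjoint (e - F.starProjection e)‖ ^ 2 + 2 * β * ‖x₀‖ ^ 2 := by
  set d := x - x₀ with hd
  have h0 : inner ℝ (T d - e) (T d) + β * inner ℝ (d + x₀) d = 0 := by
    rw [← ContinuousLinearMap.adjoint_inner_left]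
    have := congrArg (fun v => inner ℝ v d) hx
    have h1 : T x - (T x₀ + e) = T d - e := by rw [hd, map_sub]; abel
    have h2 : x = d + x₀ := by rw [hd]; abel
    rw [h1] at this
    rw [← h2]
    simpa [inner_add_left, inner_smul_left] using this
  rw [inner_sub_left, inner_add_left, real_inner_self_eq_norm_sq, real_inner_self_eq_norm_sq] at h0
  have h1 : inner ℝ e (T d) = inner ℝ (F.starProjection e) (T d) +
      inner ℝ (T.adjoint (e - F.starProjection e)) d := by
    rw [ContinuousLinearMap.adjoint_inner_left, ← inner_add_left]
    congr 1
    abel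
  have h2 := real_inner_le_norm (F.starProjection e) (T d)
  have h3 := real_inner_le_norm (T.adjoint (e - F.starProjection e)) d
  have h4 := neg_le_of_abs_le (abs_real_inner_le_norm x₀ d)
  set p := ‖F.starProjection e‖
  set q := ‖T.adjoint (e - F.starProjection e)‖
  -- Young's inequality, here and twice more, spends half of ‖Td‖² and two quarters of β‖d‖².
  -- Doubling what remains gives the factors 1, 2/β and 2β.
  have h5 : q * ‖d‖ ≤ q ^ 2 / β + β / 4 * ‖d‖ ^ 2 := by
    have : q ^ 2 / β + β / 4 * ‖d‖ ^ 2 - q * ‖d‖ = (q - β / 2 * ‖d‖) ^ 2 / β := by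
      field_simp
      ring
    have h6 : 0 ≤ (q - β / 2 * ‖d‖) ^ 2 / β := by positivity
    linarith
  have h6 : β * (‖x₀‖ * ‖d‖) ≤ β * ‖x₀‖ ^ 2 + β / 4 * ‖d‖ ^ 2 := by
    nlinarith [mul_nonneg hβ.le (sq_nonneg (‖x₀‖ - ‖d‖ / 2))]
  have h7 : β * inner ℝ x₀ d ≥ -(β * (‖x₀‖ * ‖d‖)) := by nlinarith
  have h8 : 2 / β * q ^ 2 = 2 * (q ^ 2 / β) := by ring
  rw [h8]
  nlinarith [sq_nonneg (p - ‖T d‖)]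

/-- For the projection P onto F, ‖Pb_i‖² = (Pb_i, b_i), so the sum is the trace of P. It measures
the noise energy captured by F. -/
theorem sum_norm_sq_starProjection {ι : Type*} [Fintype ι] (b : OrthonormalBasis ι ℝ G)
    (F : Submodule ℝ G) : ∑ i, ‖F.starProjection (b i)‖ ^ 2 = Module.finrank ℝ F := by
  have h : LinearMap.IsProj F F.starProjection.toLinearMap :=
    ⟨fun x => F.starProjection_apply_mem x, fun x hx => F.starProjection_eq_self_iff.2 hx⟩
  rw [← h.trace, LinearMap.trace_eq_sum_inner _ b]
  refine Finset.sum_congr rfl fun i _ => ?_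
  rw [← real_inner_self_eq_norm_sq, F.inner_starProjection_left_eq_right,
    F.starProjection_eq_self_iff.2 (F.starProjection_apply_mem _)]
  rfl

/-- As T − S maps into F, the adjoints of T and S agree on the orthogonal complement of F.
Restricting S* to this complement does not increase its Hilbert–Schmidt norm: the cross terms sum to
a trace that vanishes by cyclicity, because (1 − P)P = 0. -/
theorem sum_norm_sq_adjoint_sub_starProjection_le {ι : Type*} [Fintype ι]
    (b : OrthonormalBasis ι ℝ G) (F : Submodule ℝ G) (T S : H →L[ℝ] G)
    (hTS : ∀ x, T x - S x ∈ F) :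
    ∑ i, ‖T.adjoint (b i - F.starProjection (b i))‖ ^ 2 ≤ ∑ i, ‖S.adjoint (b i)‖ ^ 2 := by
  have hT : ∀ v, T.adjoint (v - F.starProjection v) = S.adjoint (v - F.starProjection v) := by
    intro v
    refine ext_inner_right ℝ fun x => ?_
    rw [ContinuousLinearMap.adjoint_inner_left, ContinuousLinearMap.adjoint_inner_left,
      ← sub_eq_zero, ← inner_sub_right]
    exact F.starProjection_inner_eq_zero _ _ (hTS x)
  let P : G →ₗ[ℝ] G := F.starProjection.toLinearMap
  let Q : G →ₗ[ℝ] G := LinearMap.id - P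
  let A : G →ₗ[ℝ] G := (S ∘L S.adjoint).toLinearMap
  have hcross : ∑ i, inner ℝ (S.adjoint (b i - F.starProjection (b i)))
      (S.adjoint (F.starProjection (b i))) = 0 := by
    have h1 : LinearMap.trace ℝ G ((P ∘ₗ A) ∘ₗ Q) = 0 := by
      rw [LinearMap.trace_comp_comm']
      have : Q ∘ₗ P ∘ₗ A = 0 := by
        ext v
        have : F.starProjection (F.starProjection (A v)) = F.starProjection (A v) :=
          F.starProjection_eq_self_iff.2 (F.starProjection_apply_mem _)
        simp [Q, P, this]
      rw [this, map_zero]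
    rw [LinearMap.trace_eq_sum_inner _ b] at h1
    rw [← h1]
    refine Finset.sum_congr rfl fun i _ => ?_
    rw [ContinuousLinearMap.adjoint_inner_right, ← F.inner_starProjection_left_eq_right,
      real_inner_comm]
    rfl
  have hexp : ∀ i, ‖S.adjoint (b i)‖ ^ 2 = ‖S.adjoint (b i - F.starProjection (b i))‖ ^ 2 +
      2 * inner ℝ (S.adjoint (b i - F.starProjection (b i)))
        (S.adjoint (F.starProjection (b i))) + ‖S.adjoint (F.starProjection (b i))‖ ^ 2 := by
    intro i
    rw [← norm_add_sq_real, ← map_add, sub_add_cancel]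
  simp_rw [hT, hexp, Finset.sum_add_distrib, ← Finset.mul_sum, hcross]
  have : 0 ≤ ∑ i, ‖S.adjoint (F.starProjection (b i))‖ ^ 2 :=
    Finset.sum_nonneg fun i _ => sq_nonneg _
  linarith

end Ridge

/-! ### Second moments of random combinations -/

section Noise

variable {H Ω : Type*} [NormedAddCommGroup H] [InnerProductSpace ℝ H] [MeasurableSpace Ω]
  {P : Measure Ω} {n : ℕ} {e : Fin n → Ω → ℝ}

theorem norm_sum_smul_sq (c : Fin n → ℝ) (v : Fin n → H) :
    ‖∑ i, c i • v i‖ ^ 2 = ∑ i, ∑ j, c i * c j * inner ℝ (v i) (v j) := by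
  rw [← real_inner_self_eq_norm_sq, sum_inner]
  refine Finset.sum_congr rfl fun i _ => ?_
  rw [inner_sum]
  refine Finset.sum_congr rfl fun j _ => ?_
  rw [inner_smul_left, inner_smul_right]
  simp [mul_assoc]

theorem integrable_norm_sum_smul_sq (he : ∀ i, MemLp (e i) 2 P) (v : Fin n → H) :
    Integrable (fun ω => ‖∑ i, e i ω • v i‖ ^ 2) P := by
  simp_rw [norm_sum_smul_sq]
  exact integrable_finsetSum _ fun i _ => integrable_finsetSum _ fun j _ =>
    ((he i).integrable_mul (he j)).mul_const _

/-- Independence and zero means remove all off-diagonal terms of the double sum. -/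
theorem integral_norm_sum_smul_sq_le {σ : ℝ} (he : ∀ i, MemLp (e i) 2 P) (hind : iIndepFun e P)
    (h0 : ∀ i, ∫ ω, e i ω ∂P = 0) (hvar : ∀ i, variance (e i) P ≤ σ ^ 2) (v : Fin n → H) :
    ∫ ω, ‖∑ i, e i ω • v i‖ ^ 2 ∂P ≤ σ ^ 2 * ∑ i, ‖v i‖ ^ 2 := by
  simp_rw [norm_sum_smul_sq]
  have hint : ∀ i j, Integrable (fun ω => e i ω * e j ω * inner ℝ (v i) (v j)) P :=
    fun i j => ((he i).integrable_mul (he j)).mul_const _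
  rw [integral_finsetSum _ fun i _ => integrable_finsetSum _ fun j _ => hint i j,
    Finset.mul_sum]
  refine Finset.sum_le_sum fun i _ => ?_
  rw [integral_finsetSum _ fun j _ => hint i j, Finset.sum_eq_single i]
  · rw [integral_mul_const, real_inner_self_eq_norm_sq]
    refine mul_le_mul_of_nonneg_right ?_ (sq_nonneg _)
    refine le_trans (le_of_eq ?_) (hvar i)
    rw [variance_eq_integral (he i).1.aemeasurable, h0 i]
    simp [sq]
  · intro j _ hj
    rw [integral_mul_const, (hind.indepFun hj.symm).integral_fun_mul_eq_mul_integral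
      (he i).1 (he j).1, h0 i]
    simp
  · simp

end Noise

/-! ### Iterated integrals -/

section IterInt

/-- The `k`-fold iterated integral of `g` with base point `c`. -/
noncomputable def iterInt (c : ℝ) : ℕ → (ℝ → ℝ) → ℝ → ℝ
  | 0, g => g
  | k + 1, g => iterInt c k fun t => ∫ s in c..t, g s

variable {c : ℝ} {g g' : ℝ → ℝ}

theorem _root_.MeasureTheory.LocallyIntegrable.intervalIntegrable (hg : LocallyIntegrable g)
    {u v : ℝ} : IntervalIntegrable g volume u v :=
  (hg.integrableOn_isCompact isCompact_uIcc).intervalIntegrable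

theorem _root_.MeasureTheory.LocallyIntegrable.continuous_intervalIntegral
    (hg : LocallyIntegrable g) : Continuous fun t => ∫ s in c..t, g s :=
  intervalIntegral.continuous_primitive (fun _ _ => hg.intervalIntegrable) c

theorem iterInt_add (k : ℕ) (hg : LocallyIntegrable g) (hg' : LocallyIntegrable g') :
    iterInt c k (g + g') = iterInt c k g + iterInt c k g' := by
  induction k generalizing g g' with
  | zero => rfl
  | succ k ih =>
    have h : (fun t => ∫ s in c..t, (g + g') s) =
        (fun t => ∫ s in c..t, g s) + fun t => ∫ s in c..t, g' s := by
      ext t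
      exact intervalIntegral.integral_add hg.intervalIntegrable hg'.intervalIntegrable
    simp only [iterInt]
    rw [h, ih hg.continuous_intervalIntegral.locallyIntegrable
      hg'.continuous_intervalIntegral.locallyIntegrable]

theorem iterInt_const_mul (k : ℕ) (r : ℝ) (g : ℝ → ℝ) :
    iterInt c k (fun t => r * g t) = fun t => r * iterInt c k g t := by
  induction k generalizing g with
  | zero => rfl
  | succ k ih =>
    simp only [iterInt, intervalIntegral.integral_const_mul]
    exact ih _

theorem iterInt_congr_ae {k : ℕ} (hk : k ≠ 0) (h : g =ᵐ[volume] g') :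
    iterInt c k g = iterInt c k g' := by
  obtain ⟨k, rfl⟩ := Nat.exists_eq_succ_of_ne_zero hk
  simp only [iterInt]
  congr 1
  ext t
  exact intervalIntegral.integral_congr_ae (h.mono fun _ hx _ => hx)

theorem exists_iterInt_pow (k j : ℕ) (r : ℝ) :
    ∃ r', iterInt c k (fun t => r * (t - c) ^ j) = fun t => r' * (t - c) ^ (j + k) := by
  induction k generalizing j r with
  | zero => exact ⟨r, rfl⟩
  | succ k ih =>
    have h : (fun t => ∫ s in c..t, r * (s - c) ^ j) =
        fun t => r / (j + 1) * (t - c) ^ (j + 1) := by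
      ext t
      rw [intervalIntegral.integral_const_mul,
        intervalIntegral.integral_comp_sub_right (fun x => x ^ j) c, integral_pow]
      simp
      ring
    simp only [iterInt, h]
    obtain ⟨r', hr'⟩ := ih (j + 1) (r / (j + 1))
    exact ⟨r', by rw [hr', Nat.add_right_comm]; rfl⟩

theorem continuous_iterInt {k : ℕ} (hk : k ≠ 0) (hg : LocallyIntegrable g) :
    Continuous (iterInt c k g) := by
  have h : ∀ (k : ℕ) (g : ℝ → ℝ), Continuous g → Continuous (iterInt c k g) := by
    intro k
    induction k with
    | zero => exact fun g hg => hg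
    | succ k ih => exact fun g hg => ih _ hg.locallyIntegrable.continuous_intervalIntegral
  obtain ⟨k, rfl⟩ := Nat.exists_eq_succ_of_ne_zero hk
  exact h k _ hg.continuous_intervalIntegral

theorem abs_iterInt_le {A t : ℝ} (hct : c ≤ t) (k : ℕ) (hA : ∀ s ∈ Icc c t, |g s| ≤ A) :
    |iterInt c k g t| ≤ A * (t - c) ^ k := by
  induction k generalizing g A with
  | zero => simpa [iterInt] using hA t (right_mem_Icc.2 hct)
  | succ k ih =>
    have hA0 : 0 ≤ A := (abs_nonneg _).trans (hA t (right_mem_Icc.2 hct))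
    have h := @ih (fun t => ∫ s in c..t, g s) (A * (t - c)) (fun s hs => ?_)
    · simpa only [iterInt, pow_succ', mul_assoc] using h
    · have := intervalIntegral.norm_integral_le_of_norm_le_const (a := c) (b := s) (f := g) (C := A)
        fun x hx => by
          rw [uIoc_of_le hs.1] at hx
          exact hA x ⟨hx.1.le, hx.2.trans hs.2⟩
      rw [Real.norm_eq_abs, abs_of_nonneg (sub_nonneg.2 hs.1)] at this
      exact this.trans (mul_le_mul_of_nonneg_left (by linarith [hs.2]) hA0)

/-- Cauchy–Schwarz against the constant 1, read off from ∫ ((t − c)g − I)² ≥ 0 with I = ∫ g. -/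
theorem sq_intervalIntegral_le {t : ℝ} (hct : c ≤ t) (hg : LocallyIntegrable g)
    (hg2 : LocallyIntegrable fun s => g s ^ 2) :
    (∫ s in c..t, g s) ^ 2 ≤ (t - c) * ∫ s in c..t, g s ^ 2 := by
  rcases hct.eq_or_lt with rfl | hlt
  · simp
  set I := ∫ s in c..t, g s
  set J := ∫ s in c..t, g s ^ 2
  have h0 : 0 ≤ ∫ s in c..t, ((t - c) * g s - I) ^ 2 :=
    intervalIntegral.integral_nonneg hct fun s _ => sq_nonneg _
  have h1 : ∫ s in c..t, ((t - c) * g s - I) ^ 2 =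
      (t - c) ^ 2 * J - 2 * (t - c) * I * I + (t - c) * I ^ 2 := by
    have : ∀ s, ((t - c) * g s - I) ^ 2 =
        (t - c) ^ 2 * g s ^ 2 - 2 * (t - c) * I * g s + I ^ 2 := fun s => by ring
    simp_rw [this]
    rw [intervalIntegral.integral_add, intervalIntegral.integral_sub,
      intervalIntegral.integral_const_mul, intervalIntegral.integral_const_mul,
      intervalIntegral.integral_const]
    · simp only [smul_eq_mul, I, J]
    · exact hg2.intervalIntegrable.const_mul _
    · exact hg.intervalIntegrable.const_mul _
    · exact (hg2.intervalIntegrable.const_mul _).sub (hg.intervalIntegrable.const_mul _)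
    · exact intervalIntegrable_const
  rw [h1] at h0
  have hpos : 0 < t - c := sub_pos.2 hlt
  have h2 : 0 ≤ (t - c) * ((t - c) * J - I ^ 2) := by linarith [h0]
  linarith [nonneg_of_mul_nonneg_right h2 hpos]

/-- Cauchy–Schwarz is applied to the innermost integral only. The other k − 1 integrations are
estimated in sup norm and gain a factor t − c each, so the exponent is 1 + 2(k − 1). -/
theorem sq_iterInt_le {t : ℝ} (hct : c ≤ t) {k : ℕ} (hk : k ≠ 0) (hg : LocallyIntegrable g)
    (hg2 : LocallyIntegrable fun s => g s ^ 2) :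
    iterInt c k g t ^ 2 ≤ (t - c) ^ (2 * k - 1) * ∫ s in c..t, g s ^ 2 := by
  obtain ⟨k, rfl⟩ := Nat.exists_eq_succ_of_ne_zero hk
  set J := ∫ s in c..t, g s ^ 2
  have hJ : 0 ≤ J := intervalIntegral.integral_nonneg hct fun s _ => sq_nonneg _
  have hpos : 0 ≤ t - c := sub_nonneg.2 hct
  have h := abs_iterInt_le (g := fun t => ∫ s in c..t, g s) (A := Real.sqrt ((t - c) * J)) hct k
    fun s hs => by
      refine Real.abs_le_sqrt ((sq_intervalIntegral_le hs.1 hg hg2).trans ?_)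
      refine mul_le_mul (by linarith [hs.2]) ?_
        (intervalIntegral.integral_nonneg hs.1 fun s _ => sq_nonneg _) hpos
      exact intervalIntegral.integral_mono_interval le_rfl hs.1 hs.2
        (Filter.Eventually.of_forall fun _ => sq_nonneg _) hg2.intervalIntegrable
  have h2 := pow_le_pow_left₀ (abs_nonneg _) h 2
  rw [sq_abs, mul_pow, Real.sq_sqrt (by positivity)] at h2
  refine h2.trans (le_of_eq ?_)
  have : 2 * (k + 1) - 1 = 1 + k * 2 := by omega
  rw [Nat.succ_eq_add_one, this, pow_add, pow_mul]
  ring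

end IterInt

/-! ### Weak derivatives -/

section Weak

variable {a b : ℝ}

/-- `g` is the weak derivative of order `j` of the function `f` on `(a, b)`. -/
def HasWeakDeriv (a b : ℝ) (j : ℕ) (f g : ℝ → ℝ) : Prop :=
  ∀ η : ℝ → ℝ, ContDiff ℝ (⊤ : ℕ∞) η → HasCompactSupport η → tsupport η ⊆ Ioo a b →
    ∫ t, f t * iteratedDeriv j η t ∂(intervalVol a b) =
      (-1) ^ j * ∫ t, g t * η t ∂(intervalVol a b)

theorem intervalIntegral_eq_integral_intervalVol (hab : a ≤ b) (f : ℝ → ℝ) :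
    ∫ t in a..b, f t = ∫ t, f t ∂(intervalVol a b) := by
  rw [intervalIntegral.integral_of_le hab, integral_Ioc_eq_integral_Ioo]

theorem exists_Icc_of_isCompact_subset_Ioo (hab : a < b) {s : Set ℝ} (hs : IsCompact s)
    (hsub : s ⊆ Ioo a b) : ∃ a' b', a < a' ∧ b' < b ∧ s ⊆ Icc a' b' := by
  rcases s.eq_empty_or_nonempty with rfl | hne
  · obtain ⟨c, hc⟩ := exists_between hab
    exact ⟨c, c, hc.1, hc.2, empty_subset _⟩
  · obtain ⟨x, hx⟩ := hs.exists_isLeast hne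
    obtain ⟨y, hy⟩ := hs.exists_isGreatest hne
    exact ⟨x, y, (hsub hx.1).1, (hsub hy.1).2, fun z hz => ⟨hx.2 hz, hy.2 hz⟩⟩

theorem exists_test_integral_eq_one (hab : a < b) :
    ∃ η : ℝ → ℝ, ContDiff ℝ (⊤ : ℕ∞) η ∧ HasCompactSupport η ∧ tsupport η ⊆ Ioo a b ∧
      ∫ t, η t ∂(intervalVol a b) = 1 := by
  let f : ContDiffBump ((a + b) / 2) :=
    ⟨(b - a) / 8, (b - a) / 4, by linarith, by linarith⟩
  have hsub : tsupport (f.normed volume) ⊆ Ioo a b := by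
    rw [f.tsupport_normed_eq, Real.closedBall_eq_Icc]
    intro x hx
    have h1 := hx.1
    have h2 := hx.2
    simp only [f] at h1 h2
    constructor <;> linarith
  refine ⟨f.normed volume, f.contDiff_normed, f.hasCompactSupport_normed, hsub, ?_⟩
  rw [setIntegral_eq_integral_of_forall_compl_eq_zero, f.integral_normed]
  intro x hx
  exact image_eq_zero_of_notMem_tsupport fun h => hx (hsub h)

/-- The primitive from a vanishes to the left of the support of η; to its right it equals the total
integral, which is zero. -/
theorem exists_test_antideriv (hab : a < b) {η : ℝ → ℝ} (h1 : ContDiff ℝ (⊤ : ℕ∞) η)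
    (h2 : HasCompactSupport η) (h3 : tsupport η ⊆ Ioo a b)
    (h4 : ∫ t, η t ∂(intervalVol a b) = 0) :
    ∃ θ : ℝ → ℝ, ContDiff ℝ (⊤ : ℕ∞) θ ∧ HasCompactSupport θ ∧ tsupport θ ⊆ Ioo a b ∧
      deriv θ = η := by
  obtain ⟨a', b', ha', hb', hsub⟩ := exists_Icc_of_isCompact_subset_Ioo hab h2 h3
  have hz : ∀ t, t ∉ Icc a' b' → η t = 0 := fun t ht =>
    image_eq_zero_of_notMem_tsupport fun h => ht (hsub h)
  have hd : deriv (fun t => ∫ s in a..t, η s) = η := by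
    ext t
    exact h1.continuous.deriv_integral η a t
  have hsupp : Function.support (fun t => ∫ s in a..t, η s) ⊆ Icc a' b' := by
    intro t ht
    by_contra hn
    apply ht
    rcases lt_or_ge t a' with hlt | hge
    · refine intervalIntegral.integral_zero_ae (Filter.Eventually.of_forall fun x hx => hz x ?_)
      intro hx'
      rcases mem_uIoc.1 hx with h | h
      · linarith [h.2, hx'.1]
      · linarith [h.2, hx'.1]
    · have hlt : b' < t := by
        by_contra h
        exact hn ⟨hge, not_lt.1 h⟩
      have hi : ∀ u v, IntervalIntegrable η volume u v := fun u v =>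
        h1.continuous.intervalIntegrable u v
      have e1 : ∫ s in b..t, η s = 0 := by
        refine intervalIntegral.integral_zero_ae (Filter.Eventually.of_forall fun x hx => hz x ?_)
        intro hx'
        rcases mem_uIoc.1 hx with h | h
        · linarith [h.1, hx'.2]
        · linarith [h.1, hx'.2]
      change ∫ s in a..t, η s = 0
      rw [← intervalIntegral.integral_add_adjacent_intervals (hi a b) (hi b t), e1,
        intervalIntegral_eq_integral_intervalVol hab.le, h4, add_zero]
  have hts : tsupport (fun t => ∫ s in a..t, η s) ⊆ Icc a' b' :=
    closure_minimal hsupp isClosed_Icc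
  refine ⟨fun t => ∫ s in a..t, η s, ?_, ?_, ?_, hd⟩
  · rw [contDiff_infty_iff_deriv, hd]
    refine ⟨fun t => ?_, h1⟩
    exact (h1.continuous.integral_hasStrictDerivAt a t).hasDerivAt.differentiableAt
  · exact HasCompactSupport.of_support_subset_isCompact isCompact_Icc hsupp
  · exact hts.trans fun x hx => ⟨ha'.trans_le hx.1, hx.2.trans_lt hb'⟩

/-- Integration by parts for absolutely continuous functions; θ vanishes at both ends. By Lebesgue
differentiation the primitive has derivative g almost everywhere, so g need not be continuous. -/
theorem integral_primitive_mul_deriv {c : ℝ} (hab : a < b) (hc : c ∈ Icc a b) {g θ : ℝ → ℝ}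
    (hg : LocallyIntegrable g) (h1 : ContDiff ℝ (⊤ : ℕ∞) θ) (h3 : tsupport θ ⊆ Ioo a b) :
    ∫ t, (∫ s in c..t, g s) * deriv θ t ∂(intervalVol a b) =
      -∫ t, g t * θ t ∂(intervalVol a b) := by
  have hz : ∀ t, t ∉ Ioo a b → θ t = 0 := fun t ht =>
    image_eq_zero_of_notMem_tsupport fun h => ht (h3 h)
  have hc' : c ∈ uIcc a b := by rwa [uIcc_of_le hab.le]
  have hAC := (hg.intervalIntegrable (u := a)
    (v := b)).absolutelyContinuousOnInterval_intervalIntegral hc'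
  have hθ : AbsolutelyContinuousOnInterval θ a b :=
    (h1.of_le (by exact_mod_cast le_top)).contDiffOn.absolutelyContinuousOnInterval
  have h := hAC.integral_mul_deriv_eq_deriv_mul hθ
  rw [hz a (by simp), hz b (by simp), mul_zero, mul_zero, sub_zero, zero_sub,
    intervalIntegral_eq_integral_intervalVol hab.le] at h
  rw [h, ← intervalIntegral_eq_integral_intervalVol hab.le]
  congr 1
  refine intervalIntegral.integral_congr_ae ?_
  filter_upwards [_root_.LocallyIntegrable.ae_hasDerivAt_integral hg] with t ht _
  rw [(ht c).deriv]

theorem integrable_mul_of_continuous {f θ : ℝ → ℝ} (hf : Integrable f (intervalVol a b))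
    (hθ : Continuous θ) : Integrable (fun t => f t * θ t) (intervalVol a b) := by
  obtain ⟨C, hC⟩ := (isCompact_Icc (a := a) (b := b)).exists_bound_of_continuousOn hθ.continuousOn
  refine hf.mul_bdd hθ.aestronglyMeasurable (c := C) ?_
  exact (ae_restrict_mem measurableSet_Ioo).mono fun x hx => hC x (Ioo_subset_Icc_self hx)

theorem continuous_iteratedDeriv_test {η : ℝ → ℝ} (h : ContDiff ℝ (⊤ : ℕ∞) η) (j : ℕ) :
    Continuous (iteratedDeriv j η) :=
  h.continuous_iteratedDeriv j (by exact_mod_cast le_top)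

theorem _root_.MeasureTheory.LocallyIntegrable.integrable_intervalVol {g : ℝ → ℝ}
    (hg : LocallyIntegrable g) : Integrable g (intervalVol a b) :=
  (hg.integrableOn_isCompact isCompact_Icc).mono_set Ioo_subset_Icc_self

/-- The du Bois-Reymond argument. Subtracting (∫η)η₀ from a test function η leaves mean zero, hence
a derivative θ' of a test function. Testing the order j + 1 identity with θ lowers the order, up to
a multiple of ∫η, which is the integration constant. -/
theorem HasWeakDeriv.exists_primitive {c : ℝ} {j : ℕ} {f g : ℝ → ℝ} (hab : a < b)
    (hc : c ∈ Icc a b) (hf : Integrable f (intervalVol a b)) (hg : LocallyIntegrable g)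
    (h : HasWeakDeriv a b (j + 1) f g) :
    ∃ γ : ℝ, HasWeakDeriv a b j f fun t => (∫ s in c..t, g s) + γ := by
  obtain ⟨η₀, h01, h02, h03, h04⟩ := exists_test_integral_eq_one hab
  have hV : Integrable (fun t => ∫ s in c..t, g s) (intervalVol a b) :=
    hg.continuous_intervalIntegral.locallyIntegrable.integrable_intervalVol
  set A := ∫ t, f t * iteratedDeriv j η₀ t ∂(intervalVol a b)
  set E := ∫ t, (∫ s in c..t, g s) * η₀ t ∂(intervalVol a b)
  -- This constant is forced by η = η₀, where the claim reads A = (-1)^j (E + γ).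
  refine ⟨(-1) ^ j * A - E, fun η h1 h2 h3 => ?_⟩
  set I := ∫ t, η t ∂(intervalVol a b)
  have hint : ∀ {θ : ℝ → ℝ}, Continuous θ → Integrable θ (intervalVol a b) := fun hθ =>
    hθ.locallyIntegrable.integrable_intervalVol
  have hc1 : ContDiff ℝ (⊤ : ℕ∞) (η - I • η₀) := h1.sub (h01.const_smul I)
  have hts : tsupport (η - I • η₀) ⊆ tsupport η ∪ tsupport η₀ :=
    (tsupport_sub _ _).trans (union_subset_union_right _ (closure_mono
      (Function.support_const_smul_subset _ _)))
  obtain ⟨θ, t1, t2, t3, t4⟩ := exists_test_antideriv hab hc1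
    (h2.sub (h02.smul_left (f := fun _ => I))) (hts.trans (union_subset h3 h03)) (by
      simp only [Pi.sub_apply, Pi.smul_apply, smul_eq_mul]
      rw [integral_sub (hint h1.continuous) ((hint h01.continuous).const_mul I),
        integral_const_mul, h04, mul_one, sub_self])
  have e1 := h θ t1 t2 t3
  rw [iteratedDeriv_succ', t4] at e1
  have e2 := integral_primitive_mul_deriv hab hc hg t1 t3
  rw [t4] at e2
  have e3 : iteratedDeriv j (η - I • η₀) = fun t => iteratedDeriv j η t - I * iteratedDeriv j η₀ t := by
    ext t
    have e := iteratedDeriv_sub (x := t) (n := j) (h1.of_le (by exact_mod_cast le_top)).contDiffAt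
      ((h01.const_smul I).of_le (by exact_mod_cast le_top)).contDiffAt
    refine e.trans ?_
    rw [iteratedDeriv_fun_const_smul_field]
    rfl
  rw [e3] at e1
  have e4 : ∫ t, f t * (iteratedDeriv j η t - I * iteratedDeriv j η₀ t) ∂(intervalVol a b) =
      ∫ t, f t * iteratedDeriv j η t ∂(intervalVol a b) - I * A := by
    rw [← integral_const_mul, ← integral_sub
      (integrable_mul_of_continuous hf (continuous_iteratedDeriv_test h1 j))
      ((integrable_mul_of_continuous hf (continuous_iteratedDeriv_test h01 j)).const_mul I)]
    congr 1
    ext t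
    ring
  have e5 : ∫ t, (∫ s in c..t, g s) * (η - I • η₀) t ∂(intervalVol a b) =
      ∫ t, (∫ s in c..t, g s) * η t ∂(intervalVol a b) - I * E := by
    rw [← integral_const_mul, ← integral_sub
      (integrable_mul_of_continuous hV h1.continuous)
      ((integrable_mul_of_continuous hV h01.continuous).const_mul I)]
    congr 1
    ext t
    simp only [Pi.sub_apply, Pi.smul_apply, smul_eq_mul]
    ring
  have e6 : ∫ t, ((∫ s in c..t, g s) + ((-1) ^ j * A - E)) * η t ∂(intervalVol a b) =
      ∫ t, (∫ s in c..t, g s) * η t ∂(intervalVol a b) + ((-1) ^ j * A - E) * I := by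
    rw [← integral_const_mul ((-1) ^ j * A - E), ← integral_add
      (integrable_mul_of_continuous hV h1.continuous) ((hint h1.continuous).const_mul _)]
    congr 1
    ext t
    ring
  rw [e4] at e1
  rw [e5] at e2
  rw [e6]
  have e7 : ((-1 : ℝ) ^ j) * (-1) ^ j = 1 := by
    rw [← pow_add, ← two_mul, pow_mul]
    norm_num
  rw [pow_succ] at e1
  linear_combination e1 - (-1) ^ j * e2 - I * A * e7

theorem HasWeakDeriv.ae_eq_zero_order {f g : ℝ → ℝ} (hf : Integrable f (intervalVol a b))
    (hg : Integrable g (intervalVol a b)) (h : HasWeakDeriv a b 0 f g) :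
    f =ᵐ[intervalVol a b] g := by
  have hloc : LocallyIntegrableOn (fun t => f t - g t) (Ioo a b) volume :=
    IntegrableOn.locallyIntegrableOn (hf.sub hg)
  have h0 := isOpen_Ioo.ae_eq_zero_of_integral_contDiff_smul_eq_zero hloc fun η h1 h2 h3 => by
    have e := h η h1 h2 h3
    simp only [iteratedDeriv_zero, pow_zero, one_mul] at e
    rw [← setIntegral_eq_integral_of_forall_compl_eq_zero (s := Ioo a b)]
    · rw [← sub_eq_zero, ← integral_sub (integrable_mul_of_continuous hf h1.continuous)
        (integrable_mul_of_continuous hg h1.continuous)] at e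
      rw [← e]
      congr 1
      ext t
      simp only [smul_eq_mul]
      ring
    · intro x hx
      rw [image_eq_zero_of_notMem_tsupport fun hh => hx (h3 hh), zero_smul]
  exact (ae_restrict_iff' measurableSet_Ioo).2 (h0.mono fun x hx hx' => sub_eq_zero.1 (hx hx'))

/-- Taylor's formula with integral remainder for weak derivatives. Each constant of integration,
integrated the remaining times, becomes a monomial in t − c. The base point c stays free: later it
is the left end of a cell, where the remainder is small. -/
theorem HasWeakDeriv.exists_polynomial_add_iterInt {c : ℝ} {m : ℕ} {f g : ℝ → ℝ} (hab : a < b)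
    (hc : c ∈ Icc a b) (hf : Integrable f (intervalVol a b)) (hg : LocallyIntegrable g)
    (h : HasWeakDeriv a b m f g) :
    ∃ p ∈ Polynomial.degreeLT ℝ m,
      f =ᵐ[intervalVol a b] fun t => p.eval t + iterInt c m g t := by
  induction m generalizing g with
  | zero =>
    refine ⟨0, Submodule.zero_mem _, ?_⟩
    simpa [iterInt] using h.ae_eq_zero_order hf hg.integrable_intervalVol
  | succ m ih =>
    obtain ⟨γ, hγ⟩ := h.exists_primitive hab hc hf hg
    have hV := hg.continuous_intervalIntegral (c := c)
    obtain ⟨p, hp, hpe⟩ := ih (hV.add continuous_const).locallyIntegrable hγ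
    obtain ⟨r, hr⟩ := exists_iterInt_pow (c := c) m 0 γ
    refine ⟨p + Polynomial.C r * (Polynomial.X - Polynomial.C c) ^ m,
      Submodule.add_mem _ (Polynomial.degreeLT_mono (Nat.le_succ m) hp) ?_, ?_⟩
    · rw [← Polynomial.smul_eq_C_mul]
      refine Submodule.smul_mem _ _ ?_
      rw [Polynomial.mem_degreeLT]
      refine lt_of_le_of_lt Polynomial.degree_le_natDegree ?_
      rw [Polynomial.natDegree_pow, Polynomial.natDegree_X_sub_C, mul_one]
      exact_mod_cast Nat.lt_succ_self m
    · filter_upwards [hpe] with t ht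
      have e : ((fun t => ∫ s in c..t, g s) + fun _ => γ) =
          (fun t => ∫ s in c..t, g s) + fun t => γ * (t - c) ^ 0 := by
        ext t
        simp
      rw [ht, e, iterInt_add m hV.locallyIntegrable (by fun_prop : Continuous _).locallyIntegrable,
        Pi.add_apply, hr]
      simp only [iterInt, Polynomial.eval_add, Polynomial.eval_mul, Polynomial.eval_pow,
        Polynomial.eval_sub, Polynomial.eval_C, Polynomial.eval_X, zero_add]
      ring

end Weak

/-! ### Weak derivatives of the functions in the range of an operator -/

section Range

variable {a b : ℝ}

/-- The extension by zero of `g ∈ L²(a, b)` to the real line. -/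
noncomputable def zeroExt (g : L2 a b) : ℝ → ℝ := (Ioo a b).indicator g

theorem memLp_zeroExt (g : L2 a b) : MemLp (zeroExt g) 2 volume :=
  (memLp_indicator_iff_restrict measurableSet_Ioo).2 (Lp.memLp g)

theorem locallyIntegrable_zeroExt (g : L2 a b) : LocallyIntegrable (zeroExt g) :=
  (memLp_zeroExt g).locallyIntegrable (by norm_num)

theorem integrable_sq_zeroExt (g : L2 a b) : Integrable fun t => zeroExt g t ^ 2 :=
  (memLp_zeroExt g).integrable_sq

theorem zeroExt_ae_eq (g : L2 a b) : zeroExt g =ᵐ[intervalVol a b] g :=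
  indicator_ae_eq_restrict measurableSet_Ioo

theorem zeroExt_add (f g : L2 a b) : zeroExt (f + g) =ᵐ[volume] zeroExt f + zeroExt g := by
  have h := (ae_restrict_iff' measurableSet_Ioo).1 (Lp.coeFn_add f g)
  filter_upwards [h] with t ht
  by_cases hm : t ∈ Ioo a b
  · have := ht hm
    simp only [zeroExt, Pi.add_apply, indicator_of_mem hm] at this ⊢
    exact this
  · simp [zeroExt, hm]

theorem zeroExt_smul (r : ℝ) (g : L2 a b) :
    zeroExt (r • g) =ᵐ[volume] fun t => r * zeroExt g t := by
  have h := (ae_restrict_iff' measurableSet_Ioo).1 (Lp.coeFn_smul r g)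
  filter_upwards [h] with t ht
  by_cases hm : t ∈ Ioo a b
  · simp [zeroExt, hm, ht hm]
  · simp [zeroExt, hm]

theorem integral_mul_eq_inner (f : L2 a b) {θ : ℝ → ℝ} (hθ : MemLp θ 2 (intervalVol a b)) :
    ∫ t, f t * θ t ∂(intervalVol a b) = inner ℝ (hθ.toLp θ) f := by
  rw [L2.inner_def]
  refine integral_congr_ae ?_
  filter_upwards [hθ.coeFn_toLp] with t ht
  simp [ht, mul_comm]

theorem norm_sq_eq_integral (f : L2 a b) : ‖f‖ ^ 2 = ∫ t, f t ^ 2 ∂(intervalVol a b) := by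
  rw [← real_inner_self_eq_norm_sq, L2.inner_def]
  simp [sq]

theorem integral_sq_zeroExt (hab : a ≤ b) (g : L2 a b) :
    ∫ t in a..b, zeroExt g t ^ 2 = ‖g‖ ^ 2 := by
  rw [intervalIntegral_eq_integral_intervalVol hab, norm_sq_eq_integral]
  refine integral_congr_ae ?_
  filter_upwards [zeroExt_ae_eq g] with t ht
  rw [ht]

theorem _root_.Continuous.memLp_intervalVol {θ : ℝ → ℝ} (hθ : Continuous θ) :
    MemLp θ 2 (intervalVol a b) := by
  obtain ⟨C, hC⟩ := (isCompact_Icc (a := a) (b := b)).exists_bound_of_continuousOn hθ.continuousOn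
  exact MemLp.of_bound hθ.aestronglyMeasurable C
    ((ae_restrict_mem measurableSet_Ioo).mono fun x hx => hC x (Ioo_subset_Icc_self hx))

theorem integrable_L2 (f : L2 a b) : Integrable f (intervalVol a b) :=
  (Lp.memLp f).integrable (by norm_num)

theorem isWeakDeriv_iff_inner {j : ℕ} {f g : L2 a b} :
    IsWeakDeriv a b j f g ↔ ∀ (η : ℝ → ℝ) (h : ContDiff ℝ (⊤ : ℕ∞) η), HasCompactSupport η →
      tsupport η ⊆ Ioo a b →
      inner ℝ ((continuous_iteratedDeriv_test h j).memLp_intervalVol.toLp _) f =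
        (-1) ^ j * inner ℝ (h.continuous.memLp_intervalVol.toLp η) g := by
  simp_rw [← integral_mul_eq_inner]
  rfl

theorem IsWeakDeriv.hasWeakDeriv {j : ℕ} {f g : L2 a b} (h : IsWeakDeriv a b j f g) :
    HasWeakDeriv a b j f (zeroExt g) := by
  intro η h1 h2 h3
  rw [h η h1 h2 h3]
  congr 1
  refine integral_congr_ae ?_
  filter_upwards [zeroExt_ae_eq g] with t ht
  rw [ht]

theorem IsWeakDeriv.add {j : ℕ} {f g f' g' : L2 a b} (h : IsWeakDeriv a b j f g)
    (h' : IsWeakDeriv a b j f' g') : IsWeakDeriv a b j (f + f') (g + g') := by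
  rw [isWeakDeriv_iff_inner] at *
  intro η h1 h2 h3
  rw [inner_add_right, inner_add_right, h η h1 h2 h3, h' η h1 h2 h3, mul_add]

theorem IsWeakDeriv.smul {j : ℕ} {f g : L2 a b} (h : IsWeakDeriv a b j f g) (r : ℝ) :
    IsWeakDeriv a b j (r • f) (r • g) := by
  rw [isWeakDeriv_iff_inner] at *
  intro η h1 h2 h3
  rw [inner_smul_right, inner_smul_right, h η h1 h2 h3]
  ring

/-- For a fixed test function both sides are inner products, hence continuous in L². This is the
closedness needed for the closed graph theorem. -/
theorem IsWeakDeriv.of_tendsto {j : ℕ} {u v : ℕ → L2 a b} {f g : L2 a b}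
    (h : ∀ n, IsWeakDeriv a b j (u n) (v n)) (hu : Filter.Tendsto u Filter.atTop (nhds f))
    (hv : Filter.Tendsto v Filter.atTop (nhds g)) : IsWeakDeriv a b j f g := by
  simp_rw [isWeakDeriv_iff_inner] at *
  intro η h1 h2 h3
  refine tendsto_nhds_unique (Filter.Tendsto.inner tendsto_const_nhds hu) ?_
  simp_rw [fun n => h n η h1 h2 h3]
  exact (Filter.Tendsto.inner tendsto_const_nhds hv).const_mul _

theorem IsWeakDeriv.unique {j : ℕ} {f g g' : L2 a b} (h : IsWeakDeriv a b j f g)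
    (h' : IsWeakDeriv a b j f g') : g = g' := by
  have h0 : HasWeakDeriv a b 0 g g' := by
    intro η h1 h2 h3
    have e := (h η h1 h2 h3).symm.trans (h' η h1 h2 h3)
    have := mul_left_cancel₀ (pow_ne_zero j (by norm_num : (-1 : ℝ) ≠ 0)) e
    simpa using this
  exact Lp.ext (h0.ae_eq_zero_order (integrable_L2 g) (integrable_L2 g'))

/-- Uniqueness makes the m-th weak derivative of Kx linear in x, and closedness makes it bounded.
From here on ‖D‖ carries the smoothing property of K quantitatively. -/
theorem exists_weakDeriv_clm (K : L2 a b →L[ℝ] L2 a b) {m : ℕ}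
    (hK : ∀ x, ∃ g, IsWeakDeriv a b m (K x) g) :
    ∃ D : L2 a b →L[ℝ] L2 a b, ∀ x, IsWeakDeriv a b m (K x) (D x) := by
  choose d hd using hK
  let D : L2 a b →ₗ[ℝ] L2 a b :=
    { toFun := d
      map_add' := fun x y => by
        have h := (hd x).add (hd y)
        rw [← map_add] at h
        exact (hd (x + y)).unique h
      map_smul' := fun r x => by
        have h := (hd x).smul r
        rw [← map_smul] at h
        exact (hd (r • x)).unique h }
  refine ⟨⟨D, D.continuous_of_seq_closed_graph fun u x g hu hg => ?_⟩, hd⟩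
  exact (IsWeakDeriv.of_tendsto (fun n => hd (u n)) ((K.continuous.tendsto x).comp hu) hg).unique
    (hd x)

/-! ### Point values -/

theorem eqOn_Icc_of_ae_eq_intervalVol (hab : a < b) {u v : ℝ → ℝ} (hu : ContinuousOn u (Icc a b))
    (hv : ContinuousOn v (Icc a b)) (h : u =ᵐ[intervalVol a b] v) : EqOn u v (Icc a b) := by
  rw [intervalVol, Measure.restrict_congr_set Ioo_ae_eq_Icc] at h
  exact Measure.eqOn_Icc_of_ae_eq volume hab.ne h hu hv

theorem contRep_eqOn (hab : a < b) {f : L2 a b} {u : ℝ → ℝ} (hu : ContinuousOn u (Icc a b))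
    (h : f =ᵐ[intervalVol a b] u) : EqOn (contRep f) u (Icc a b) := by
  have hex : ∃ g : ℝ → ℝ, ContinuousOn g (Icc a b) ∧ f =ᵐ[intervalVol a b] g := ⟨u, hu, h⟩
  rw [contRep, dif_pos hex]
  exact eqOn_Icc_of_ae_eq_intervalVol hab hex.choose_spec.1 hu (hex.choose_spec.2.symm.trans h)

theorem exists_contRep_eq (hab : a < b) {m : ℕ} (hm : m ≠ 0) {f g : L2 a b}
    (h : IsWeakDeriv a b m f g) {c : ℝ} (hc : c ∈ Icc a b) :
    ∃ p ∈ Polynomial.degreeLT ℝ m, (f =ᵐ[intervalVol a b]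
      fun t => p.eval t + iterInt c m (zeroExt g) t) ∧
      ∀ t ∈ Icc a b, contRep f t = p.eval t + iterInt c m (zeroExt g) t := by
  obtain ⟨p, hp, hpe⟩ := h.hasWeakDeriv.exists_polynomial_add_iterInt hab hc (integrable_L2 f)
    (locallyIntegrable_zeroExt g)
  exact ⟨p, hp, hpe, contRep_eqOn hab
    (p.continuous.add (continuous_iterInt hm (locallyIntegrable_zeroExt g))).continuousOn hpe⟩

theorem continuousOn_contRep (hab : a < b) {m : ℕ} (hm : m ≠ 0) {f g : L2 a b}
    (h : IsWeakDeriv a b m f g) :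
    ContinuousOn (contRep f) (Icc a b) ∧ f =ᵐ[intervalVol a b] contRep f := by
  obtain ⟨p, -, hpe, hpt⟩ := exists_contRep_eq hab hm h (left_mem_Icc.2 hab.le)
  have hcont : Continuous fun t => p.eval t + iterInt a m (zeroExt g) t :=
    p.continuous.add (continuous_iterInt hm (locallyIntegrable_zeroExt g))
  refine ⟨hcont.continuousOn.congr hpt, hpe.trans ?_⟩
  exact (ae_restrict_mem measurableSet_Ioo).mono fun t ht => (hpt t (Ioo_subset_Icc_self ht)).symm

theorem norm_sq_eq_integral_contRep (hab : a < b) {m : ℕ} (hm : m ≠ 0) {f g : L2 a b}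
    (h : IsWeakDeriv a b m f g) : ‖f‖ ^ 2 = ∫ t in a..b, contRep f t ^ 2 := by
  rw [norm_sq_eq_integral, intervalIntegral_eq_integral_intervalVol hab.le]
  refine integral_congr_ae ?_
  filter_upwards [(continuousOn_contRep hab hm h).2] with t ht
  rw [ht]

theorem contRep_add (hab : a < b) {m : ℕ} (hm : m ≠ 0) {f g f' g' : L2 a b}
    (h : IsWeakDeriv a b m f g) (h' : IsWeakDeriv a b m f' g') {t : ℝ} (ht : t ∈ Icc a b) :
    contRep (f + f') t = contRep f t + contRep f' t := by
  have h1 := continuousOn_contRep hab hm h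
  have h2 := continuousOn_contRep hab hm h'
  refine contRep_eqOn hab (u := fun t => contRep f t + contRep f' t) (h1.1.add h2.1) ?_ ht
  filter_upwards [Lp.coeFn_add f f', h1.2, h2.2] with s e1 e2 e3
  rw [e1, Pi.add_apply, e2, e3]

theorem contRep_smul (hab : a < b) {m : ℕ} (hm : m ≠ 0) {f g : L2 a b}
    (h : IsWeakDeriv a b m f g) (r : ℝ) {t : ℝ} (ht : t ∈ Icc a b) :
    contRep (r • f) t = r * contRep f t := by
  have h1 := continuousOn_contRep hab hm h
  refine contRep_eqOn hab (u := fun t => r * contRep f t) (h1.1.const_mul r) ?_ ht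
  filter_upwards [Lp.coeFn_smul r f, h1.2] with s e1 e2
  rw [e1, Pi.smul_apply, e2, smul_eq_mul]

/-- The functional `x ↦ (J_c^m x)(t)`, with `J_c` the integration with base point `c`. -/
theorem exists_iterInt_clm {m : ℕ} (hm : m ≠ 0) {c t : ℝ} (hac : a ≤ c) (hct : c ≤ t)
    (htb : t ≤ b) :
    ∃ L : L2 a b →L[ℝ] ℝ, (∀ g, L g = iterInt c m (zeroExt g) t) ∧
      ‖L‖ ^ 2 ≤ (t - c) ^ (2 * m - 1) := by
  let L : L2 a b →ₗ[ℝ] ℝ :=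
    { toFun := fun g => iterInt c m (zeroExt g) t
      map_add' := fun f g => by
        rw [iterInt_congr_ae hm (zeroExt_add f g), iterInt_add m (locallyIntegrable_zeroExt f)
          (locallyIntegrable_zeroExt g), Pi.add_apply]
      map_smul' := fun r g => by
        rw [iterInt_congr_ae hm (zeroExt_smul r g), iterInt_const_mul]
        rfl }
  have hpos : 0 ≤ t - c := sub_nonneg.2 hct
  have hbound : ∀ g, ‖L g‖ ≤ Real.sqrt ((t - c) ^ (2 * m - 1)) * ‖g‖ := by
    intro g
    rw [← Real.sqrt_sq (norm_nonneg g), ← Real.sqrt_mul (by positivity), Real.norm_eq_abs]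
    refine Real.abs_le_sqrt ((sq_iterInt_le hct hm (locallyIntegrable_zeroExt g)
      (integrable_sq_zeroExt g).locallyIntegrable).trans ?_)
    refine mul_le_mul_of_nonneg_left ?_ (by positivity)
    rw [← integral_sq_zeroExt (hac.trans (hct.trans htb)) g]
    exact intervalIntegral.integral_mono_interval hac hct htb
      (Filter.Eventually.of_forall fun _ => sq_nonneg _)
      (integrable_sq_zeroExt g).intervalIntegrable
  refine ⟨L.mkContinuous _ hbound, fun g => rfl, ?_⟩
  refine (pow_le_pow_left₀ (norm_nonneg _)
    (L.mkContinuous_norm_le (Real.sqrt_nonneg _) hbound) 2).trans_eq ?_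
  exact Real.sq_sqrt (pow_nonneg hpos _)

end Range

/-! ### Polynomial interpolation at separated nodes -/

section Nodes

/-- In the Lagrange form each basis polynomial is a product of m − 1 quotients |x − t_j| / |t_i −
t_j| ≤ ℓ/d. -/
theorem abs_eval_le_of_separated {m : ℕ} {p : Polynomial ℝ} (hp : p ∈ Polynomial.degreeLT ℝ m)
    {t : Fin m → ℝ} {d ℓ x : ℝ} (hd : 0 < d) (hsep : ∀ i j, i ≠ j → d ≤ |t i - t j|)
    (hx : ∀ i, |x - t i| ≤ ℓ) :
    |p.eval x| ≤ (ℓ / d) ^ (m - 1) * ∑ i, |p.eval (t i)| := by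
  have hinj : InjOn t (Finset.univ : Finset (Fin m)) := by
    intro i _ j _ hij
    by_contra hne
    have := hsep i j hne
    rw [hij, sub_self, abs_zero] at this
    linarith
  have hdeg : p.degree < (Finset.univ : Finset (Fin m)).card := by
    simpa using Polynomial.mem_degreeLT.1 hp
  have hL := congrArg (Polynomial.eval x) (Lagrange.eq_interpolate hinj hdeg)
  rw [Lagrange.interpolate_apply, Polynomial.eval_finsetSum] at hL
  rw [hL, Finset.mul_sum]
  refine (Finset.abs_sum_le_sum_abs _ _).trans (Finset.sum_le_sum fun i _ => ?_)
  rw [Polynomial.eval_mul, Polynomial.eval_C, abs_mul, mul_comm]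
  refine mul_le_mul_of_nonneg_right ?_ (abs_nonneg _)
  rw [Lagrange.basis, Polynomial.eval_prod, Finset.abs_prod]
  have hcard : (Finset.univ.erase i).card = m - 1 := by simp
  rw [← hcard, ← Finset.prod_const]
  refine Finset.prod_le_prod (fun _ _ => abs_nonneg _) fun j hj => ?_
  have hne : i ≠ j := (Finset.ne_of_mem_erase hj).symm
  rw [Lagrange.basisDivisor, Polynomial.eval_mul, Polynomial.eval_C, Polynomial.eval_sub,
    Polynomial.eval_X, Polynomial.eval_C, abs_mul, abs_inv, inv_mul_eq_div]
  exact div_le_div₀ ((abs_nonneg _).trans (hx j)) (hx j) hd (hsep i j hne)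

/-- Replace u by p at the nodes, interpolate p, and return to u at x; every replacement costs ρ. -/
theorem sq_le_of_polynomial_approx {m : ℕ} (hm : m ≠ 0) {p : Polynomial ℝ}
    (hp : p ∈ Polynomial.degreeLT ℝ m) {u : ℝ → ℝ} {t : Fin m → ℝ} {d ℓ ρ x : ℝ} (hd : 0 < d)
    (hsep : ∀ i j, i ≠ j → d ≤ |t i - t j|) (hx : ∀ i, |x - t i| ≤ ℓ)
    (hux : |u x - p.eval x| ≤ ρ) (hut : ∀ i, |u (t i) - p.eval (t i)| ≤ ρ) :
    u x ^ 2 ≤ 2 * ((ℓ / d) ^ (m - 1) * m + 1) ^ 2 * (∑ i, u (t i) ^ 2 + ρ ^ 2) := by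
  have hm1 : (1 : ℝ) ≤ m := by exact_mod_cast Nat.one_le_iff_ne_zero.2 hm
  have hℓ : 0 ≤ ℓ := (abs_nonneg _).trans (hx ⟨0, Nat.pos_of_ne_zero hm⟩)
  have h1 := abs_eval_le_of_separated hp hd hsep hx
  set Λ := (ℓ / d) ^ (m - 1)
  have hΛ : 0 ≤ Λ := by positivity
  have hρ : 0 ≤ ρ := (abs_nonneg _).trans hux
  have h2 : ∑ i, |p.eval (t i)| ≤ ∑ i, |u (t i)| + m * ρ := by
    have : ∑ i, |p.eval (t i)| ≤ ∑ i, (|u (t i)| + ρ) := by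
      refine Finset.sum_le_sum fun i _ => ?_
      have := abs_sub_abs_le_abs_sub (p.eval (t i)) (u (t i))
      rw [abs_sub_comm] at this
      linarith [hut i]
    simpa [Finset.sum_add_distrib] using this
  have h3 : |u x| ≤ Λ * ∑ i, |u (t i)| + (Λ * m + 1) * ρ := by
    have e1 := abs_sub_abs_le_abs_sub (u x) (p.eval x)
    have e2 := mul_le_mul_of_nonneg_left h2 hΛ
    nlinarith
  have h4 : (∑ i, |u (t i)|) ^ 2 ≤ m * ∑ i, u (t i) ^ 2 := by
    have := sq_sum_le_card_mul_sum_sq (s := (Finset.univ : Finset (Fin m)))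
      (f := fun i => |u (t i)|)
    simpa using this
  set S := ∑ i, |u (t i)|
  set Q := ∑ i, u (t i) ^ 2
  have hQ : 0 ≤ Q := Finset.sum_nonneg fun i _ => sq_nonneg _
  have h5 : u x ^ 2 ≤ (Λ * S + (Λ * m + 1) * ρ) ^ 2 := by
    rw [← sq_abs]
    exact pow_le_pow_left₀ (abs_nonneg _) h3 2
  have h6 : Λ ^ 2 * S ^ 2 ≤ (Λ * m + 1) ^ 2 * Q := by
    have e1 : Λ ^ 2 * S ^ 2 ≤ Λ ^ 2 * (m * Q) := mul_le_mul_of_nonneg_left h4 (sq_nonneg _)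
    have e2 : Λ ^ 2 * m ≤ (Λ * m + 1) ^ 2 := by
      have : Λ ^ 2 * m ≤ Λ ^ 2 * m ^ 2 :=
        mul_le_mul_of_nonneg_left (by nlinarith) (sq_nonneg _)
      nlinarith [mul_nonneg hΛ (zero_le_one.trans hm1)]
    calc Λ ^ 2 * S ^ 2 ≤ Λ ^ 2 * m * Q := by rw [mul_assoc]; exact e1
      _ ≤ _ := mul_le_mul_of_nonneg_right e2 hQ
  nlinarith [sq_nonneg (Λ * S - (Λ * m + 1) * ρ)]

/-- The constant of the local estimate of a Sobolev function by `m` of its values. -/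
noncomputable def cellConst (m : ℕ) : ℝ := 2 * ((2 * m : ℝ) ^ (m - 1) * m + 1) ^ 2

theorem cellConst_pos (m : ℕ) : 0 < cellConst m := by
  unfold cellConst
  positivity

variable {a b : ℝ}

/-- Expand at the left end of a cell of length 4md. The nodes lie in m windows of width 2d separated
by gaps 2d, so the interpolation ratio is 4md/(2d) = 2m and the constant depends on m alone. -/
theorem sq_contRep_le_cell (hab : a < b) {m : ℕ} (hm : m ≠ 0) {f g : L2 a b}
    (h : IsWeakDeriv a b m f g) {c d : ℝ} (hd : 0 < d) (hac : a ≤ c) (hcb : c + 4 * m * d ≤ b)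
    {t : Fin m → ℝ} (ht : ∀ i, |t i - (c + (4 * i + 2) * d)| ≤ d) {x : ℝ}
    (hx : x ∈ Icc c (c + 4 * m * d)) :
    contRep f x ^ 2 ≤ cellConst m * (∑ i, contRep f (t i) ^ 2 +
      (4 * m * d) ^ (2 * m - 1) * ∫ s in c..(c + 4 * m * d), zeroExt g s ^ 2) := by
  have hℓ : 0 ≤ 4 * m * d := by positivity
  obtain ⟨p, hp, -, hpt⟩ := exists_contRep_eq hab hm h (c := c) ⟨hac, by linarith⟩
  set ℓ := 4 * m * d with hℓd
  set J := ∫ s in c..(c + ℓ), zeroExt g s ^ 2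
  have hJ : 0 ≤ J := intervalIntegral.integral_nonneg (by linarith) fun s _ => sq_nonneg _
  have htm : ∀ i, t i ∈ Icc c (c + ℓ) := by
    intro i
    have h1 := abs_le.1 (ht i)
    have h2 : (i : ℝ) + 1 ≤ m := by exact_mod_cast i.2
    have h3 : (0 : ℝ) ≤ i := Nat.cast_nonneg _
    constructor <;> nlinarith
  have happ : ∀ s ∈ Icc c (c + ℓ), |contRep f s - p.eval s| ≤ Real.sqrt (ℓ ^ (2 * m - 1) * J) := by
    intro s hs
    rw [hpt s ⟨hac.trans hs.1, hs.2.trans hcb⟩, add_sub_cancel_left]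
    refine Real.abs_le_sqrt ((sq_iterInt_le hs.1 hm (locallyIntegrable_zeroExt g)
      (integrable_sq_zeroExt g).locallyIntegrable).trans ?_)
    refine mul_le_mul (pow_le_pow_left₀ (sub_nonneg.2 hs.1) (by linarith [hs.2]) _) ?_
      (intervalIntegral.integral_nonneg hs.1 fun s _ => sq_nonneg _) (by positivity)
    exact intervalIntegral.integral_mono_interval le_rfl hs.1 hs.2
      (Filter.Eventually.of_forall fun _ => sq_nonneg _) (integrable_sq_zeroExt g).intervalIntegrable
  have hsep : ∀ i j, i ≠ j → 2 * d ≤ |t i - t j| := by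
    have key : ∀ i j : Fin m, i < j → 2 * d ≤ |t i - t j| := by
      intro i j hij
      have h1 := abs_le.1 (ht i)
      have h2 := abs_le.1 (ht j)
      have h3 : (i : ℝ) + 1 ≤ j := by exact_mod_cast hij
      rw [abs_sub_comm]
      refine le_trans ?_ (le_abs_self _)
      nlinarith
    intro i j hij
    rcases lt_or_gt_of_ne hij with hlt | hlt
    · exact key i j hlt
    · rw [abs_sub_comm]
      exact key j i hlt
  have hfin := sq_le_of_polynomial_approx hm hp (u := contRep f) (ℓ := ℓ) (d := 2 * d)
    (by positivity) hsep (x := x)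
    (fun i => abs_le.2 ⟨by linarith [hx.1, (htm i).2], by linarith [hx.2, (htm i).1]⟩)
    (happ x hx) (fun i => happ _ (htm i))
  rw [Real.sq_sqrt (by positivity)] at hfin
  have hratio : ℓ / (2 * d) = 2 * m := by
    rw [hℓd]
    field_simp
    ring
  rwa [hratio] at hfin

theorem intervalIntegrable_sq_contRep (hab : a < b) {m : ℕ} (hm : m ≠ 0) {f g : L2 a b}
    (h : IsWeakDeriv a b m f g) {u v : ℝ} (hau : a ≤ u) (huv : u ≤ v) (hvb : v ≤ b) :
    IntervalIntegrable (fun t => contRep f t ^ 2) volume u v := by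
  refine ContinuousOn.intervalIntegrable ?_
  rw [uIcc_of_le huv]
  exact ((continuousOn_contRep hab hm h).1.pow 2).mono (Icc_subset_Icc hau hvb)

/-- Sobolev embedding, with [a, b] as a single cell. In each window the node is a minimum point of
f², where f² is at most its mean over the window and hence at most ‖f‖²/(2d). -/
theorem sq_contRep_le_norm (hab : a < b) {m : ℕ} (hm : m ≠ 0) :
    ∃ C : ℝ, 0 < C ∧ ∀ f g : L2 a b, IsWeakDeriv a b m f g → ∀ x ∈ Icc a b,
      contRep f x ^ 2 ≤ C * (‖f‖ ^ 2 + ‖g‖ ^ 2) := by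
  have hm0 : (0 : ℝ) < m := by exact_mod_cast Nat.pos_of_ne_zero hm
  obtain ⟨d, hdd⟩ : ∃ d, d = (b - a) / (4 * m) := ⟨_, rfl⟩
  have hd : 0 < d := by
    rw [hdd]
    exact div_pos (sub_pos.2 hab) (by positivity)
  have hℓ : 4 * m * d = b - a := by
    rw [hdd]
    field_simp
  have hb : a + 4 * m * d = b := by linarith
  refine ⟨cellConst m * (m / (2 * d) + (b - a) ^ (2 * m - 1)),
    mul_pos (cellConst_pos m) (add_pos_of_pos_of_nonneg (by positivity)
      (pow_nonneg (sub_nonneg.2 hab.le) _)), fun f g h x hx => ?_⟩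
  have hex : ∀ i : Fin m, ∃ t, |t - (a + (4 * i + 2) * d)| ≤ d ∧
      contRep f t ^ 2 ≤ ‖f‖ ^ 2 / (2 * d) := by
    intro i
    have h2 : (i : ℝ) + 1 ≤ m := by exact_mod_cast i.2
    have h3 : (0 : ℝ) ≤ i := Nat.cast_nonneg _
    obtain ⟨u, hu⟩ : ∃ u, u = a + (4 * i + 1) * d := ⟨_, rfl⟩
    have hau : a ≤ u := by rw [hu]; nlinarith
    have hub : u + 2 * d ≤ b := by rw [hu]; nlinarith
    have hle : u ≤ u + 2 * d := by linarith
    obtain ⟨t, ht, hmin⟩ := isCompact_Icc.exists_isMinOn (nonempty_Icc.2 hle)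
      (((continuousOn_contRep hab hm h).1.pow 2).mono (Icc_subset_Icc hau hub))
    refine ⟨t, abs_le.2 ⟨by linarith [ht.1], by linarith [ht.2]⟩, ?_⟩
    rw [le_div_iff₀ (by positivity), norm_sq_eq_integral_contRep hab hm h]
    calc contRep f t ^ 2 * (2 * d) = ∫ _ in u..(u + 2 * d), contRep f t ^ 2 := by
          rw [intervalIntegral.integral_const, smul_eq_mul]
          ring
      _ ≤ ∫ s in u..(u + 2 * d), contRep f s ^ 2 :=
          intervalIntegral.integral_mono_on hle intervalIntegrable_const
            (intervalIntegrable_sq_contRep hab hm h hau hle hub) fun s hs => hmin hs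
      _ ≤ _ := intervalIntegral.integral_mono_interval hau hle hub
          (Filter.Eventually.of_forall fun _ => sq_nonneg _)
          (intervalIntegrable_sq_contRep hab hm h le_rfl hab.le le_rfl)
  choose t ht1 ht2 using hex
  have hfin := sq_contRep_le_cell hab hm h hd le_rfl hb.le ht1 (x := x) (by rwa [hb])
  rw [hb, integral_sq_zeroExt hab.le, hℓ] at hfin
  refine hfin.trans ?_
  rw [mul_assoc]
  refine mul_le_mul_of_nonneg_left ?_ (cellConst_pos m).le
  have hs : ∑ i, contRep f (t i) ^ 2 ≤ m / (2 * d) * ‖f‖ ^ 2 := by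
    refine (Finset.sum_le_sum fun i _ => ht2 i).trans_eq ?_
    rw [Finset.sum_const, Finset.card_univ, Fintype.card_fin, nsmul_eq_mul]
    ring
  have hP : 0 ≤ (b - a) ^ (2 * m - 1) := pow_nonneg (sub_nonneg.2 hab.le) _
  have hA : 0 ≤ m / (2 * d) := by positivity
  nlinarith [mul_nonneg hA (sq_nonneg ‖g‖), mul_nonneg hP (sq_nonneg ‖f‖)]

end Nodes

/-! ### Sampling -/

section Sampling

variable {a b : ℝ} {n : ℕ} {s : Fin n → ℝ}

theorem exists_abs_sub_le_fillDist (hn : 0 < n) (hs : ∀ i, s i ∈ Icc a b) {x : ℝ}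
    (hx : x ∈ Icc a b) : ∃ i, |x - s i| ≤ fillDist a b s := by
  have : Nonempty (Fin n) := ⟨⟨0, hn⟩⟩
  obtain ⟨i, hi⟩ := exists_eq_ciInf_of_finite (f := fun i => |x - s i|)
  refine ⟨i, hi.le.trans ?_⟩
  refine le_ciSup (f := fun x : Icc a b => ⨅ i : Fin n, |(x : ℝ) - s i|) ⟨b - a, ?_⟩ ⟨x, hx⟩
  rintro _ ⟨z, rfl⟩
  refine (ciInf_le ⟨0, ?_⟩ (⟨0, hn⟩ : Fin n)).trans (abs_le.2 ⟨?_, ?_⟩)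
  · rintro _ ⟨j, rfl⟩
    exact abs_nonneg _
  · linarith [z.2.1, (hs ⟨0, hn⟩).2]
  · linarith [z.2.2, (hs ⟨0, hn⟩).1]

theorem fillDist_pos (hab : a < b) (hn : 0 < n) (hs : ∀ i, s i ∈ Icc a b) :
    0 < fillDist a b s := by
  by_contra hneg
  have : Icc a b ⊆ range s := by
    intro x hx
    obtain ⟨i, hi⟩ := exists_abs_sub_le_fillDist hn hs hx
    have : |x - s i| = 0 := le_antisymm (hi.trans (not_lt.1 hneg)) (abs_nonneg _)
    exact ⟨i, (sub_eq_zero.1 (abs_eq_zero.1 this)).symm⟩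
  exact Icc_infinite hab ((finite_range s).subset this)

/-- Each consecutive gap satisfies h ≤ |B| · gap. The gaps telescope to (n − 1)h ≤ |B|(b − a), and n
≤ 2(n − 1). -/
theorem IsQuasiUniform.fillDist_mul_le {B : ℝ} (hs : IsQuasiUniform a b B s) (hab : a < b)
    (hn : 2 ≤ n) : fillDist a b s * n ≤ 2 * |B| * (b - a) := by
  have hpos := fillDist_pos hab (by omega) hs.mem_Icc
  have hstep : ∀ j (hj : j < n),
      j * fillDist a b s ≤ |B| * (s ⟨j, hj⟩ - s ⟨0, by omega⟩) := by
    intro j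
    induction j with
    | zero => intro hj; simp
    | succ j ih =>
      intro hj
      have h1 := ih (by omega)
      have hlt : s ⟨j, by omega⟩ < s ⟨j + 1, hj⟩ := hs.strictMono (by simp)
      have h2 := hs.fillDist_le ⟨j + 1, hj⟩ ⟨j, by omega⟩ (by simp)
      rw [abs_of_pos (sub_pos.2 hlt)] at h2
      have h3 := mul_le_mul_of_nonneg_right (le_abs_self B) (sub_pos.2 hlt).le
      push_cast
      linarith
  have h1 := hstep (n - 1) (by omega)
  have h2 : (2 : ℝ) ≤ n := by exact_mod_cast hn
  have h3 : ((n - 1 : ℕ) : ℝ) = n - 1 := by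
    rw [Nat.cast_sub (by omega)]
    simp
  rw [h3] at h1
  have h4 : s ⟨n - 1, by omega⟩ - s ⟨0, by omega⟩ ≤ b - a := by
    linarith [(hs.mem_Icc ⟨n - 1, by omega⟩).2, (hs.mem_Icc ⟨0, by omega⟩).1]
  have h5 := mul_le_mul_of_nonneg_left h4 (abs_nonneg B)
  nlinarith

/-- Cut [a, b] into cells of length 4md with h ≤ d ≤ 2h. Each window of half-width d contains a
sampling point, and the windows are disjoint, so no sampled value is used twice and the cell
estimates can be summed. -/
theorem norm_sq_le_sampling (hab : a < b) {m : ℕ} (hm : m ≠ 0) {f g : L2 a b}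
    (h : IsWeakDeriv a b m f g) (hn : 0 < n) (hs : ∀ i, s i ∈ Icc a b)
    (hh : 4 * m * fillDist a b s ≤ b - a) :
    ‖f‖ ^ 2 ≤ cellConst m * (8 * m * fillDist a b s * ∑ i, contRep f (s i) ^ 2 +
      (8 * m * fillDist a b s) ^ (2 * m) * ‖g‖ ^ 2) := by
  have hm0 : (0 : ℝ) < m := by exact_mod_cast Nat.pos_of_ne_zero hm
  have hH := fillDist_pos hab hn hs
  set H := fillDist a b s with hHdef
  -- The largest number of equal cells of length at least 4mh. Rounding down a number ≥ 1 loses at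
  -- most a factor 2, whence d ≤ 2h.
  obtain ⟨L, hLdef⟩ : ∃ L, L = ⌊(b - a) / (4 * m * H)⌋₊ := ⟨_, rfl⟩
  have hq : 1 ≤ (b - a) / (4 * m * H) := (one_le_div (by positivity)).2 hh
  have hL1 : 1 ≤ L := hLdef ▸ Nat.one_le_floor_iff _ |>.2 hq
  have hL0 : (0 : ℝ) < L := by exact_mod_cast hL1
  have hL1' : (1 : ℝ) ≤ L := by exact_mod_cast hL1
  have hLle : L * (4 * m * H) ≤ b - a := by
    rw [← le_div_iff₀ (by positivity), hLdef]
    exact Nat.floor_le (zero_le_one.trans hq)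
  have hLlt : b - a < (L + 1) * (4 * m * H) := by
    rw [← div_lt_iff₀ (by positivity), hLdef]
    exact Nat.lt_floor_add_one _
  obtain ⟨d, hdd⟩ : ∃ d, d = (b - a) / (4 * m * L) := ⟨_, rfl⟩
  have hdL : L * (4 * m * d) = b - a := by
    rw [hdd]
    field_simp
  have hHd : H ≤ d := by
    have : 0 < L * (4 * (m : ℝ)) := by positivity
    have h1 : L * (4 * m) * H ≤ L * (4 * m) * d := by linarith
    exact le_of_mul_le_mul_left h1 this
  have hd2 : d ≤ 2 * H := by
    have : 0 < L * (4 * (m : ℝ)) := by positivity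
    have h1 : L * (4 * m) * d ≤ L * (4 * m) * (2 * H) := by
      have : 0 ≤ (L - 1) * (4 * m * H) := mul_nonneg (by linarith) (by positivity)
      nlinarith
    exact le_of_mul_le_mul_left h1 this
  have hd : 0 < d := hH.trans_le hHd
  set ℓ := 4 * m * d with hℓd
  have hℓ : 0 < ℓ := by positivity
  let z : ℕ → ℝ := fun j => a + j * ℓ
  have hz : ∀ j, z (j + 1) = z j + ℓ := fun j => by simp only [z]; push_cast; ring
  have hza : ∀ j, a ≤ z j := fun j => by simp only [z]; nlinarith [Nat.cast_nonneg (α := ℝ) j]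
  have hzb : ∀ j < L, z j + ℓ ≤ b := by
    intro j hj
    have : (j : ℝ) + 1 ≤ L := by exact_mod_cast hj
    simp only [z]
    nlinarith
  have hpt : ∀ (j : Fin L) (r : Fin m), ∃ i, |s i - (z j + (4 * r + 2) * d)| ≤ d := by
    intro j r
    have h2 : (r : ℝ) + 1 ≤ m := by exact_mod_cast r.2
    have h3 : (0 : ℝ) ≤ r := Nat.cast_nonneg _
    obtain ⟨i, hi⟩ := exists_abs_sub_le_fillDist hn hs (x := z j + (4 * r + 2) * d)
      ⟨by nlinarith [hza j], by nlinarith [hzb j j.2]⟩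
    exact ⟨i, by rw [abs_sub_comm]; exact hi.trans hHd⟩
  choose idx hidx using hpt
  -- Window r of cell j is centred at a + (4(jm + r) + 2)d. A common point forces two centres to
  -- within 2d, so the integers jm + r coincide.
  have hinj : Function.Injective fun q : Fin L × Fin m => idx q.1 q.2 := by
    rintro ⟨j, r⟩ ⟨j', r'⟩ heq
    simp only at heq
    have e1 := abs_le.1 (hidx j r)
    have e2 := abs_le.1 (hidx j' r')
    rw [← heq] at e2
    have e3 : |(((j : ℕ) * m + r : ℤ) - ((j' : ℕ) * m + r') : ℤ)| < 1 := by
      have : |((((j : ℕ) * m + r : ℤ) - ((j' : ℕ) * m + r') : ℤ) : ℝ)| < 1 := by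
        push_cast
        rw [abs_lt]
        simp only [z, hℓd] at e1 e2
        constructor <;> nlinarith
      exact_mod_cast this
    have e4 : (j : ℕ) * m + r = (j' : ℕ) * m + r' := by
      have := Int.abs_lt_one_iff.1 e3
      have : ((j : ℕ) * m + r : ℤ) = (j' : ℕ) * m + r' := by linarith
      exact_mod_cast this
    have e5 : (r : ℕ) = r' := by
      have := congrArg (· % m) e4
      simpa [Nat.mul_add_mod', Nat.mod_eq_of_lt r.2, Nat.mod_eq_of_lt r'.2] using this
    have e6 : (j : ℕ) = j' := by
      rw [e5] at e4
      exact Nat.eq_of_mul_eq_mul_right (Nat.pos_of_ne_zero hm) (by omega)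
    exact Prod.ext (Fin.ext e6) (Fin.ext e5)
  have hcell : ∀ j : Fin L, ∫ t in z j..z (j + 1), contRep f t ^ 2 ≤
      ℓ * (cellConst m * (∑ r, contRep f (s (idx j r)) ^ 2 +
        ℓ ^ (2 * m - 1) * ∫ t in z j..z (j + 1), zeroExt g t ^ 2)) := by
    intro j
    rw [hz]
    have hle : z j ≤ z j + ℓ := by linarith
    refine (intervalIntegral.integral_mono_on hle
      (intervalIntegrable_sq_contRep hab hm h (hza j) hle (hzb j j.2)) intervalIntegrable_const
      fun x hx => sq_contRep_le_cell hab hm h hd (hza j) (hzb j j.2) (hidx j) hx).trans_eq ?_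
    rw [intervalIntegral.integral_const, smul_eq_mul, add_sub_cancel_left]
  have hzL : z L = b := by
    simp only [z]
    linarith
  have hz0 : z 0 = a := by simp [z]
  have hsum1 : ∑ j : Fin L, ∫ t in z j..z (j + 1), contRep f t ^ 2 = ‖f‖ ^ 2 := by
    rw [norm_sq_eq_integral_contRep hab hm h, Fin.sum_univ_eq_sum_range
      (fun j => ∫ t in z j..z (j + 1), contRep f t ^ 2),
      intervalIntegral.sum_integral_adjacent_intervals, hz0, hzL]
    intro j hj
    rw [hz]
    exact intervalIntegrable_sq_contRep hab hm h (hza j) (by linarith) (hzb j hj)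
  have hsum2 : ∑ j : Fin L, ∫ t in z j..z (j + 1), zeroExt g t ^ 2 = ‖g‖ ^ 2 := by
    rw [← integral_sq_zeroExt hab.le g, Fin.sum_univ_eq_sum_range
      (fun j => ∫ t in z j..z (j + 1), zeroExt g t ^ 2),
      intervalIntegral.sum_integral_adjacent_intervals, hz0, hzL]
    exact fun j _ => (integrable_sq_zeroExt g).intervalIntegrable
  have hsum3 : ∑ j : Fin L, ∑ r, contRep f (s (idx j r)) ^ 2 ≤ ∑ i, contRep f (s i) ^ 2 := by
    rw [← Fintype.sum_prod_type' (fun j r => contRep f (s (idx j r)) ^ 2),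
      ← Finset.sum_image (f := fun i => contRep f (s i) ^ 2)
        (g := fun q : Fin L × Fin m => idx q.1 q.2) hinj.injOn]
    exact Finset.sum_le_sum_of_subset_of_nonneg (Finset.subset_univ _) fun _ _ _ => sq_nonneg _
  have hℓ8 : ℓ ≤ 8 * m * H := by
    rw [hℓd]
    nlinarith
  have hpow : ℓ * ℓ ^ (2 * m - 1) = ℓ ^ (2 * m) := by
    rw [← pow_succ']
    congr 1
    omega
  calc ‖f‖ ^ 2 ≤ ∑ j : Fin L, ℓ * (cellConst m * (∑ r, contRep f (s (idx j r)) ^ 2 +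
        ℓ ^ (2 * m - 1) * ∫ t in z j..z (j + 1), zeroExt g t ^ 2)) := by
        rw [← hsum1]
        exact Finset.sum_le_sum fun j _ => hcell j
    _ = cellConst m * (ℓ * (∑ j : Fin L, ∑ r, contRep f (s (idx j r)) ^ 2) +
        ℓ ^ (2 * m) * ‖g‖ ^ 2) := by
        rw [← Finset.mul_sum, ← Finset.mul_sum, Finset.sum_add_distrib, ← Finset.mul_sum, hsum2,
          ← hpow]
        ring
    _ ≤ _ := by
        refine mul_le_mul_of_nonneg_left ?_ (cellConst_pos m).le
        refine add_le_add (mul_le_mul hℓ8 hsum3 (Finset.sum_nonneg fun _ _ =>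
          Finset.sum_nonneg fun _ _ => sq_nonneg _) (by positivity)) ?_
        exact mul_le_mul_of_nonneg_right (pow_le_pow_left₀ hℓ.le hℓ8 _) (sq_nonneg _)

end Sampling

/-! ### The dual norm -/

section Dual

variable {a b : ℝ} {K : L2 a b →L[ℝ] L2 a b} {ι : Type*} {sv : ι → ℝ} {φ ψ : ι → L2 a b}

/-- Parseval in the closed span of φ. The vector u is arbitrary, since only its projection onto that
span meets v. -/
theorem hasSum_inner_mul_inner_of_mem_closure {H : Type*} [NormedAddCommGroup H]
    [InnerProductSpace ℝ H] [CompleteSpace H] {φ : ι → H} (hφ : Orthonormal ℝ φ) (u : H) {v : H}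
    (hv : v ∈ (Submodule.span ℝ (range φ)).topologicalClosure) :
    HasSum (fun j => inner ℝ u (φ j) * inner ℝ v (φ j)) (inner ℝ u v) := by
  set E := (Submodule.span ℝ (range φ)).topologicalClosure with hE
  have hmem : ∀ j, φ j ∈ E := fun j =>
    Submodule.le_topologicalClosure _ (Submodule.subset_span (mem_range_self j))
  have : CompleteSpace E :=
    (Submodule.isClosed_topologicalClosure _).isComplete.completeSpace_coe
  let φ' : ι → E := fun j => ⟨φ j, hmem j⟩
  have hφ' : Orthonormal ℝ φ' := by
    refine ⟨fun j => hφ.1 j, fun i j hij => hφ.2 hij⟩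
  have hbot : (Submodule.span ℝ (range φ'))ᗮ = ⊥ := by
    rw [Submodule.eq_bot_iff]
    intro w hw
    have h1 : ∀ j, inner ℝ (φ j) (w : H) = 0 := fun j =>
      (Submodule.mem_orthogonal _ _).1 hw (φ' j) (Submodule.subset_span (mem_range_self j))
    have h2 : (w : H) ∈ (Submodule.span ℝ (range φ))ᗮ := by
      rw [Submodule.mem_orthogonal]
      intro z hz
      induction hz using Submodule.span_induction with
      | mem z hz => obtain ⟨j, rfl⟩ := hz; exact h1 j
      | zero => exact inner_zero_left _
      | add y z _ _ hy hz => rw [inner_add_left, hy, hz, add_zero]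
      | smul r z _ hz => rw [inner_smul_left, hz, mul_zero]
    rw [← Submodule.orthogonal_closure] at h2
    have h3 := (Submodule.mem_orthogonal _ _).1 h2 w w.2
    exact Subtype.ext (inner_self_eq_zero.1 h3)
  let β := HilbertBasis.mkOfOrthogonalEqBot hφ' hbot
  have hβ : ∀ j, ((β j : E) : H) = φ j := fun j => by
    simp only [β, HilbertBasis.coe_mkOfOrthogonalEqBot, φ']
  have h := β.hasSum_inner_mul_inner (E.orthogonalProjectionOnto u) ⟨v, hv⟩
  have e1 : ∀ w : E, inner ℝ (E.orthogonalProjectionOnto u) w = inner ℝ u (w : H) :=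
    fun w => E.inner_orthogonalProjectionOnto_eq_of_mem_right w u
  have e2 : ∀ j, inner ℝ (β j) (⟨v, hv⟩ : E) = inner ℝ v (φ j) := fun j => by
    rw [← hβ j, real_inner_comm]
    rfl
  simp_rw [e1, e2, hβ] at h
  exact h

/-- Cauchy–Schwarz with weights s_j^{1/2} and s_j^{-1/2} separates u from v. Then ∑ s_j u_j² = ∑
(Ku, ψ_j) u_j, which Cauchy–Schwarz and Bessel's inequality bound by ‖Ku‖ ‖u‖. -/
theorem sq_inner_le_of_mem_spaceW (h : IsSingularSystem K sv φ ψ) (u : L2 a b) {v : L2 a b}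
    (hv : v ∈ spaceW K sv φ) : inner ℝ u v ^ 2 ≤ ‖K u‖ * ‖u‖ * normW sv φ v ^ 2 := by
  have hnn : ∀ j, 0 ≤ inner ℝ v (φ j) ^ 2 / sv j := fun j => div_nonneg (sq_nonneg _) (h.pos j).le
  rw [normW, Real.sq_sqrt (tsum_nonneg hnn)]
  have hs := hasSum_inner_mul_inner_of_mem_closure h.orthonormal_left u (v := v)
    (by rw [h.complete]; exact hv.1)
  refine le_of_tendsto (hs.pow 2) (Filter.Eventually.of_forall fun S => ?_)
  have hKu : ∀ j, inner ℝ (ψ j) (K u) = sv j * inner ℝ u (φ j) := fun j => by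
    rw [← ContinuousLinearMap.adjoint_inner_left, h.adjoint_map_right, inner_smul_left,
      real_inner_comm]
    rfl
  have h1 : (∑ j ∈ S, inner ℝ u (φ j) * inner ℝ v (φ j)) ^ 2 ≤
      (∑ j ∈ S, sv j * inner ℝ u (φ j) ^ 2) * ∑ j ∈ S, inner ℝ v (φ j) ^ 2 / sv j := by
    refine Finset.sum_sq_le_sum_mul_sum_of_sq_le_mul S
      (fun j _ => mul_nonneg (h.pos j).le (sq_nonneg _)) (fun j _ => hnn j) fun j _ => ?_
    have := (h.pos j).ne'
    refine le_of_eq ?_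
    field_simp
  have h2 : (∑ j ∈ S, sv j * inner ℝ u (φ j) ^ 2) ≤ ‖K u‖ * ‖u‖ := by
    refine abs_le_of_sq_le_sq' ?_ (by positivity) |>.2
    have e1 : (∑ j ∈ S, sv j * inner ℝ u (φ j) ^ 2) =
        ∑ j ∈ S, inner ℝ (ψ j) (K u) * inner ℝ (φ j) u := by
      refine Finset.sum_congr rfl fun j _ => ?_
      rw [hKu, real_inner_comm u]
      ring
    rw [e1, mul_pow]
    refine (Finset.sum_mul_sq_le_sq_mul_sq S _ _).trans ?_
    have e2 := h.orthonormal_right.sum_inner_products_le (K u) (s := S)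
    have e3 := h.orthonormal_left.sum_inner_products_le u (s := S)
    simp only [Real.norm_eq_abs, sq_abs] at e2 e3
    exact mul_le_mul e2 e3 (Finset.sum_nonneg fun _ _ => sq_nonneg _) (sq_nonneg _)
  have h3 : ∑ j ∈ S, inner ℝ v (φ j) ^ 2 / sv j ≤ ∑' j, inner ℝ v (φ j) ^ 2 / sv j :=
    hv.2.sum_le_tsum S fun j _ => hnn j
  exact h1.trans (mul_le_mul h2 h3 (Finset.sum_nonneg fun j _ => hnn j) (by positivity))

theorem abs_inner_div_normW_le (h : IsSingularSystem K sv φ ψ) (u : L2 a b) {v : L2 a b}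
    (hv : v ∈ spaceW K sv φ) : |inner ℝ u v| / normW sv φ v ≤ Real.sqrt (‖K u‖ * ‖u‖) := by
  have hN : 0 ≤ normW sv φ v := Real.sqrt_nonneg _
  refine div_le_of_le_mul₀ hN (Real.sqrt_nonneg _) ?_
  refine (Real.abs_le_sqrt (sq_inner_le_of_mem_spaceW h u hv)).trans_eq ?_
  rw [Real.sqrt_mul (by positivity), Real.sqrt_sq hN]

theorem normWDual_nonneg (u : L2 a b) : 0 ≤ normWDual K sv φ u :=
  Real.sSup_nonneg (by
    rintro _ ⟨v, -, -, rfl⟩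
    exact div_nonneg (abs_nonneg _) (Real.sqrt_nonneg _))

theorem normWDual_le_sqrt (h : IsSingularSystem K sv φ ψ) (u : L2 a b) :
    normWDual K sv φ u ≤ Real.sqrt (‖K u‖ * ‖u‖) :=
  Real.sSup_le (by
    rintro _ ⟨v, hv, -, rfl⟩
    exact abs_inner_div_normW_le h u hv) (Real.sqrt_nonneg _)

/-- The interpolation inequality for the dual norm. -/
theorem normWDual_sq_le (h : IsSingularSystem K sv φ ψ) (u : L2 a b) :
    normWDual K sv φ u ^ 2 ≤ ‖K u‖ * ‖u‖ := by
  rw [← Real.sq_sqrt (by positivity : 0 ≤ ‖K u‖ * ‖u‖)]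
  exact pow_le_pow_left₀ (normWDual_nonneg u) (normWDual_le_sqrt h u) 2

theorem normWDual_le_add (h : IsSingularSystem K sv φ ψ) (u u' : L2 a b) :
    normWDual K sv φ u ≤ normWDual K sv φ u' + normWDual K sv φ (u - u') := by
  refine Real.sSup_le ?_ (add_nonneg (normWDual_nonneg _) (normWDual_nonneg _))
  rintro _ ⟨v, hv, hv0, rfl⟩
  have hle : ∀ w, |inner ℝ w v| / normW sv φ v ≤ normWDual K sv φ w := fun w =>
    le_csSup ⟨Real.sqrt (‖K w‖ * ‖w‖), by
      rintro _ ⟨v', hv', -, rfl⟩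
      exact abs_inner_div_normW_le h w hv'⟩ ⟨v, hv, hv0, rfl⟩
  refine le_trans ?_ (add_le_add (hle u') (hle (u - u')))
  rw [← add_div]
  refine div_le_div_of_nonneg_right ?_ (Real.sqrt_nonneg _)
  have : (inner ℝ u v : ℝ) = inner ℝ u' v + inner ℝ (u - u') v := by
    rw [← inner_add_left, add_sub_cancel]
  rw [this]
  exact abs_add_le _ _

/-- Subadditivity and ‖u‖_{W*}² ≤ ‖K‖ ‖u‖² make the dual norm Lipschitz. The measurability of the
random error rests on this. -/
theorem continuous_normWDual (h : IsSingularSystem K sv φ ψ) :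
    Continuous (normWDual K sv φ) := by
  refine (LipschitzWith.of_le_add_mul (Real.toNNReal (Real.sqrt ‖K‖)) fun u u' => ?_).continuous
  refine (normWDual_le_add h u u').trans (add_le_add_right ?_ _)
  refine (normWDual_le_sqrt h _).trans ?_
  rw [Real.coe_toNNReal _ (Real.sqrt_nonneg _), dist_eq_norm,
    ← Real.sqrt_sq (norm_nonneg (u - u')), ← Real.sqrt_mul (norm_nonneg K),
    Real.sqrt_sq (norm_nonneg _)]
  refine Real.sqrt_le_sqrt ?_
  rw [sq, ← mul_assoc]
  exact mul_le_mul_of_nonneg_right (K.le_opNorm _) (norm_nonneg _)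

end Dual

/-! ### Observation operators -/

section Rows

set_option linter.unusedSectionVars false

variable {H : Type*} [NormedAddCommGroup H] [InnerProductSpace ℝ H] [CompleteSpace H] {n : ℕ}

/-- The operator into `ℝⁿ` whose components are the given functionals. -/
noncomputable def ofRows (L : Fin n → H →L[ℝ] ℝ) : H →L[ℝ] EuclideanSpace ℝ (Fin n) :=
  (EuclideanSpace.equiv (Fin n) ℝ).symm.toContinuousLinearMap ∘L ContinuousLinearMap.pi L

@[simp]
theorem ofRows_apply (L : Fin n → H →L[ℝ] ℝ) (x : H) (i : Fin n) : ofRows L x i = L i x := rfl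

/-- The adjoint sends the i-th basis vector to the Riesz representative of `L i`. -/
theorem norm_adjoint_ofRows_le (L : Fin n → H →L[ℝ] ℝ) (i : Fin n) :
    ‖(ofRows L).adjoint (EuclideanSpace.basisFun (Fin n) ℝ i)‖ ≤ ‖L i‖ := by
  set v := (ofRows L).adjoint (EuclideanSpace.basisFun (Fin n) ℝ i)
  have h : L i v = ‖v‖ ^ 2 := by
    rw [← real_inner_self_eq_norm_sq, ContinuousLinearMap.adjoint_inner_left,
      EuclideanSpace.basisFun_apply, EuclideanSpace.inner_single_left]
    simp
  have h1 := (le_abs_self _).trans ((L i).le_opNorm v)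
  rw [h, sq] at h1
  rcases (norm_nonneg v).eq_or_lt with h0 | h0
  · rw [← h0]
    exact norm_nonneg _
  · exact le_of_mul_le_mul_right h1 h0

theorem sum_norm_sq_adjoint_ofRows_le {L : Fin n → H →L[ℝ] ℝ} {c : ℝ} (h : ∀ i, ‖L i‖ ^ 2 ≤ c) :
    ∑ i, ‖(ofRows L).adjoint (EuclideanSpace.basisFun (Fin n) ℝ i)‖ ^ 2 ≤ n * c := by
  refine (Finset.sum_le_sum fun i _ => (pow_le_pow_left₀ (norm_nonneg _)
    (norm_adjoint_ofRows_le L i) 2).trans (h i)).trans_eq ?_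
  simp

/-- The stochastic error bound for ridge regression, in terms of a subspace `F` that contains the
range of `T - S`. -/
theorem exists_ridge_majorant {Ω : Type*} [MeasurableSpace Ω] {P : Measure Ω} {e : Fin n → Ω → ℝ}
    {σ β : ℝ} (hβ : 0 < β) (he : ∀ i, MemLp (e i) 2 P) (hP : IsProbabilityMeasure P)
    (hind : iIndepFun e P)
    (h0 : ∀ i, ∫ ω, e i ω ∂P = 0) (hvar : ∀ i, variance (e i) P ≤ σ ^ 2)
    (T S : H →L[ℝ] EuclideanSpace ℝ (Fin n)) (F : Submodule ℝ (EuclideanSpace ℝ (Fin n)))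
    (hTS : ∀ x, T x - S x ∈ F) (x₀ : H) :
    ∃ Z : Ω → ℝ, Integrable Z P ∧
      ∫ ω, Z ω ∂P ≤ σ ^ 2 * (Module.finrank ℝ F +
        2 / β * ∑ i, ‖S.adjoint (EuclideanSpace.basisFun (Fin n) ℝ i)‖ ^ 2) +
        2 * β * ‖x₀‖ ^ 2 ∧
      ∀ ω x, T.adjoint (T x - (T x₀ + WithLp.toLp 2 fun i => e i ω)) + β • x = 0 →
        ‖T (x - x₀)‖ ^ 2 + β * ‖x - x₀‖ ^ 2 ≤ Z ω := by
  let bas := EuclideanSpace.basisFun (Fin n) ℝ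
  have hsum : ∀ ω, (WithLp.toLp 2 fun i => e i ω : EuclideanSpace ℝ (Fin n)) =
      ∑ i, e i ω • bas i := by
    intro ω
    ext j
    simp [bas, Finset.sum_apply, Pi.single_apply]
  let v₁ := fun i => F.starProjection (bas i)
  let v₂ := fun i => T.adjoint (bas i - F.starProjection (bas i))
  have hI₁ := integrable_norm_sum_smul_sq he v₁
  have hI₂ := (integrable_norm_sum_smul_sq he v₂).const_mul (2 / β)
  refine ⟨fun ω => ‖∑ i, e i ω • v₁ i‖ ^ 2 + 2 / β * ‖∑ i, e i ω • v₂ i‖ ^ 2 + 2 * β * ‖x₀‖ ^ 2,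
    (hI₁.add hI₂).add (integrable_const _), ?_, fun ω x hx => ?_⟩
  · have hI₃ : Integrable
        (fun ω => ‖∑ i, e i ω • v₁ i‖ ^ 2 + 2 / β * ‖∑ i, e i ω • v₂ i‖ ^ 2) P := hI₁.add hI₂
    rw [integral_add hI₃ (integrable_const _), integral_add hI₁ hI₂, integral_const_mul]
    have e1 := integral_norm_sum_smul_sq_le he hind h0 hvar v₁
    have e2 := integral_norm_sum_smul_sq_le he hind h0 hvar v₂
    have e3 := sum_norm_sq_starProjection bas F
    have e4 := sum_norm_sq_adjoint_sub_starProjection_le bas F T S hTS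
    have e5 : σ ^ 2 * ∑ i, ‖v₂ i‖ ^ 2 ≤ σ ^ 2 * ∑ i, ‖S.adjoint (bas i)‖ ^ 2 :=
      mul_le_mul_of_nonneg_left e4 (sq_nonneg _)
    have e6 := mul_le_mul_of_nonneg_left (e2.trans e5) (by positivity : 0 ≤ 2 / β)
    rw [e3] at e1
    simp only [integral_const, probReal_univ, one_smul]
    linarith
  · have h := ridge_error T F hβ hx
    rw [hsum, map_sum] at h
    simp only [map_smul] at h
    rw [← Finset.sum_sub_distrib, map_sum] at h
    simp only [← smul_sub, map_smul] at h
    exact h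

end Rows

/-! ### Effective dimension and sampling inequality for operators with range in H^m -/

section Sobolev

variable {a b : ℝ} {K D : L2 a b →L[ℝ] L2 a b} {m : ℕ}

theorem exists_point_clm (hab : a < b) (hm : m ≠ 0)
    (hD : ∀ x, IsWeakDeriv a b m (K x) (D x)) :
    ∃ C : ℝ, 0 < C ∧ ∀ t ∈ Icc a b, ∃ L : L2 a b →L[ℝ] ℝ,
      (∀ x, L x = contRep (K x) t) ∧ ‖L‖ ^ 2 ≤ C := by
  obtain ⟨C, hC, hCb⟩ := sq_contRep_le_norm hab hm
  have hC' : 0 < C * (‖K‖ ^ 2 + ‖D‖ ^ 2 + 1) := by positivity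
  refine ⟨_, hC', fun t ht => ?_⟩
  let L : L2 a b →ₗ[ℝ] ℝ :=
    { toFun := fun x => contRep (K x) t
      map_add' := fun x y => by rw [map_add, contRep_add hab hm (hD x) (hD y) ht]
      map_smul' := fun r x => by
        rw [map_smul, contRep_smul hab hm (hD x) r ht]
        rfl }
  have hbound : ∀ x, ‖L x‖ ≤ Real.sqrt (C * (‖K‖ ^ 2 + ‖D‖ ^ 2 + 1)) * ‖x‖ := by
    intro x
    rw [← Real.sqrt_sq (norm_nonneg x), ← Real.sqrt_mul hC'.le, Real.norm_eq_abs]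
    refine Real.abs_le_sqrt ((hCb _ _ (hD x) t ht).trans ?_)
    rw [mul_assoc]
    refine mul_le_mul_of_nonneg_left ?_ hC.le
    have h1 := pow_le_pow_left₀ (norm_nonneg _) (K.le_opNorm x) 2
    have h2 := pow_le_pow_left₀ (norm_nonneg _) (D.le_opNorm x) 2
    rw [mul_pow] at h1 h2
    nlinarith [sq_nonneg ‖x‖]
  refine ⟨L.mkContinuous _ hbound, fun x => rfl, ?_⟩
  refine (pow_le_pow_left₀ (norm_nonneg _)
    (L.mkContinuous_norm_le (Real.sqrt_nonneg _) hbound) 2).trans_eq ?_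
  exact Real.sq_sqrt hC'.le

/-- The values at the sampling points of functions that are polynomials of degree `< m` on each of
finitely many cells form a space of dimension at most `m` times the number of cells. -/
theorem exists_piecewise_polynomial_space {n : ℕ} (s : Fin n → ℝ) (M m : ℕ)
    (cell : Fin n → Fin M) :
    ∃ F : Submodule ℝ (EuclideanSpace ℝ (Fin n)), Module.finrank ℝ F ≤ M * m ∧
      ∀ q : Fin M → Polynomial ℝ, (∀ j, q j ∈ Polynomial.degreeLT ℝ m) →
        (WithLp.toLp 2 fun i => (q (cell i)).eval (s i)) ∈ F := by
  let Φ : (Fin M → Polynomial.degreeLT ℝ m) →ₗ[ℝ] EuclideanSpace ℝ (Fin n) :=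
    { toFun := fun q => WithLp.toLp 2 fun i => (q (cell i) : Polynomial ℝ).eval (s i)
      map_add' := fun q q' => by
        ext i
        simp
      map_smul' := fun r q => by
        ext i
        simp }
  refine ⟨LinearMap.range Φ, ?_, fun q hq => ⟨fun j => ⟨q j, hq j⟩, rfl⟩⟩
  refine (LinearMap.finrank_range_le Φ).trans_eq ?_
  have e := (LinearEquiv.piCongrRight fun _ : Fin M => Polynomial.degreeLTEquiv ℝ m).finrank_eq
  rw [e, Module.finrank_pi_fintype]
  simp

/-- Expand Kx at the left end of the cell that contains s_i. The polynomial depends only on the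
cell, so its samples lie in F, and the remainder is an m-fold integral of Dx over at most one cell
length. The cell of index M is there only for s_i = b. -/
theorem exists_cell_approx (hab : a < b) (hm : m ≠ 0)
    (hD : ∀ x, IsWeakDeriv a b m (K x) (D x)) {M : ℕ} (hM : M ≠ 0) {n : ℕ} {s : Fin n → ℝ}
    (hs : ∀ i, s i ∈ Icc a b) :
    ∃ (F : Submodule ℝ (EuclideanSpace ℝ (Fin n))) (L : Fin n → L2 a b →L[ℝ] ℝ),
      Module.finrank ℝ F ≤ (M + 1) * m ∧
      (∀ i, ‖L i‖ ^ 2 ≤ ‖D‖ ^ 2 * ((b - a) / M) ^ (2 * m - 1)) ∧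
      ∀ x, (WithLp.toLp 2 fun i => contRep (K x) (s i) - L i x) ∈ F := by
  have hM0 : (0 : ℝ) < M := by exact_mod_cast Nat.pos_of_ne_zero hM
  obtain ⟨δ, hδ⟩ : ∃ δ, δ = (b - a) / M := ⟨_, rfl⟩
  have hδ0 : 0 < δ := by
    rw [hδ]
    exact div_pos (sub_pos.2 hab) hM0
  have hMδ : M * δ = b - a := by
    rw [hδ]
    field_simp
  have hfl : ∀ i, 0 ≤ (s i - a) / δ := fun i => div_nonneg (sub_nonneg.2 (hs i).1) hδ0.le
  have hcell : ∀ i, ⌊(s i - a) / δ⌋₊ < M + 1 := by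
    intro i
    rw [Nat.floor_lt (hfl i), div_lt_iff₀ hδ0]
    push_cast
    nlinarith [(hs i).2]
  let cell : Fin n → Fin (M + 1) := fun i => ⟨_, hcell i⟩
  let c : Fin (M + 1) → ℝ := fun j => a + j * δ
  have hc1 : ∀ j, a ≤ c j := fun j => le_add_of_nonneg_right (by positivity)
  have hc2 : ∀ j, c j ≤ b := fun j => by
    have : ((j : ℕ) : ℝ) ≤ M := by exact_mod_cast Nat.lt_succ_iff.1 j.2
    have := mul_le_mul_of_nonneg_right this hδ0.le
    simp only [c]
    linarith
  have hc3 : ∀ i, c (cell i) ≤ s i := fun i => by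
    have := (le_div_iff₀ hδ0).1 (Nat.floor_le (hfl i))
    simp only [c, cell]
    linarith
  have hc4 : ∀ i, s i - c (cell i) ≤ δ := fun i => by
    have := (div_lt_iff₀ hδ0).1 (Nat.lt_floor_add_one ((s i - a) / δ))
    simp only [c, cell]
    linarith
  choose L hL1 hL2 using fun i => exists_iterInt_clm hm (hc1 (cell i)) (hc3 i) (hs i).2
  obtain ⟨F, hF1, hF2⟩ := exists_piecewise_polynomial_space s (M + 1) m cell
  refine ⟨F, fun i => L i ∘L D, hF1, fun i => ?_, fun x => ?_⟩
  · have h1 := pow_le_pow_left₀ (norm_nonneg _) ((L i).opNorm_comp_le D) 2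
    rw [mul_pow, mul_comm] at h1
    refine h1.trans (mul_le_mul_of_nonneg_left ((hL2 i).trans ?_) (sq_nonneg _))
    rw [← hδ]
    exact pow_le_pow_left₀ (sub_nonneg.2 (hc3 i)) (hc4 i) _
  · choose p hp1 _ hp3 using fun j => exists_contRep_eq hab hm (hD x) (c := c j) ⟨hc1 j, hc2 j⟩
    convert hF2 p hp1 using 2
    ext i
    rw [hp3 (cell i) (s i) (hs i), ContinuousLinearMap.comp_apply, hL1, add_sub_cancel_right]

/-- The bound for the effective dimension. -/
theorem exists_effective_dimension_bound (hab : a < b) (hm : m ≠ 0)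
    (hD : ∀ x, IsWeakDeriv a b m (K x) (D x)) :
    ∃ C : ℝ, 0 < C ∧ ∀ (n : ℕ) (s : Fin n → ℝ) (α : ℝ), 0 < n → (∀ i, s i ∈ Icc a b) → 0 < α →
      ∃ (T S : L2 a b →L[ℝ] EuclideanSpace ℝ (Fin n))
        (F : Submodule ℝ (EuclideanSpace ℝ (Fin n))),
        (∀ x i, T x i = contRep (K x) (s i)) ∧ (∀ x, T x - S x ∈ F) ∧
        Module.finrank ℝ F + 2 / (n * α) *
          ∑ i, ‖S.adjoint (EuclideanSpace.basisFun (Fin n) ℝ i)‖ ^ 2 ≤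
            C * α ^ (-(1 / (2 * m)) : ℝ) := by
  obtain ⟨C₁, hC₁, hpt⟩ := exists_point_clm hab hm hD
  have hm0 : (0 : ℝ) < m := by exact_mod_cast Nat.pos_of_ne_zero hm
  have hm1 : (1 : ℝ) ≤ m := by exact_mod_cast Nat.one_le_iff_ne_zero.2 hm
  set C₂ := ‖D‖ ^ 2 * (b - a) ^ (2 * m - 1)
  have hC₂ : 0 ≤ C₂ := mul_nonneg (sq_nonneg _) (pow_nonneg (sub_nonneg.2 hab.le) _)
  refine ⟨2 * C₁ + 3 * m + 2 * C₂, by positivity, fun n s α hn hs hα => ?_⟩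
  have hn0 : (0 : ℝ) < n := by exact_mod_cast hn
  choose L hL1 hL2 using fun i => hpt (s i) (hs i)
  have hE : 0 < α ^ (-(1 / (2 * m)) : ℝ) := Real.rpow_pos_of_pos hα _
  have hscale : ∀ c : ℝ, 2 / (n * α) * (n * c) = 2 * c * α⁻¹ := fun c => by
    field_simp
  rcases le_or_gt 1 α with h1 | h1
  -- For α ≥ 1 no polynomials are needed: point evaluations are bounded and α⁻¹ ≤ α^{-1/(2m)}.
  · refine ⟨ofRows L, ofRows L, ⊥, fun x i => hL1 i x, fun x => by simp, ?_⟩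
    rw [finrank_bot, Nat.cast_zero, zero_add]
    refine (mul_le_mul_of_nonneg_left (sum_norm_sq_adjoint_ofRows_le hL2)
      (by positivity)).trans ?_
    rw [hscale]
    have h2 : α⁻¹ ≤ α ^ (-(1 / (2 * m)) : ℝ) := by
      rw [← Real.rpow_neg_one]
      refine Real.rpow_le_rpow_of_exponent_le h1 (neg_le_neg ?_)
      rw [div_le_one (by positivity)]
      linarith
    calc 2 * C₁ * α⁻¹ ≤ 2 * C₁ * α ^ (-(1 / (2 * m)) : ℝ) :=
          mul_le_mul_of_nonneg_left h2 (by positivity)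
      _ ≤ _ := mul_le_mul_of_nonneg_right (by linarith [mul_pos three_pos hm0]) hE.le
  -- With ⌈E⌉ cells, dim F ≤ (E + 2)m ≤ 3mE. The remainder costs a multiple of E^{-(2m-1)} α⁻¹ = E,
  -- since α⁻¹ = E^{2m}; this choice balances the two.
  · set E := α ^ (-(1 / (2 * m)) : ℝ) with hEdef
    have hE1 : 1 ≤ E := Real.one_le_rpow_of_pos_of_le_one_of_nonpos hα h1.le (by
      rw [neg_nonpos]
      positivity)
    have hM1 : E ≤ ⌈E⌉₊ := Nat.le_ceil _
    have hM2 : (⌈E⌉₊ : ℝ) < E + 1 := Nat.ceil_lt_add_one hE.le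
    have hM : ⌈E⌉₊ ≠ 0 := (Nat.ceil_pos.2 hE).ne'
    obtain ⟨F, L', hF, hL', hTS⟩ := exists_cell_approx hab hm hD hM hs
    refine ⟨ofRows L, ofRows L', F, fun x i => hL1 i x, fun x => ?_, ?_⟩
    · convert hTS x using 1
      ext i
      simp [hL1]
    · have hf : (Module.finrank ℝ F : ℝ) ≤ 3 * m * E := by
        have : (Module.finrank ℝ F : ℝ) ≤ (⌈E⌉₊ + 1) * m := by exact_mod_cast hF
        nlinarith
      have hδ : ‖D‖ ^ 2 * ((b - a) / ⌈E⌉₊) ^ (2 * m - 1) * α⁻¹ ≤ C₂ * E := by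
        have e1 : ((b - a) / ⌈E⌉₊) ^ (2 * m - 1) ≤ (b - a) ^ (2 * m - 1) / E ^ (2 * m - 1) := by
          rw [div_pow]
          exact div_le_div_of_nonneg_left (pow_nonneg (sub_nonneg.2 hab.le) _) (by positivity)
            (pow_le_pow_left₀ hE.le hM1 _)
        have e2 : α⁻¹ = E ^ (2 * m - 1) * E := by
          rw [← pow_succ, ← Real.rpow_natCast, hEdef, ← Real.rpow_mul hα.le, ← Real.rpow_neg_one]
          congr 1
          have : 2 * m - 1 + 1 = 2 * m := by omega
          rw [this]
          push_cast
          field_simp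
        calc ‖D‖ ^ 2 * ((b - a) / ⌈E⌉₊) ^ (2 * m - 1) * α⁻¹
            ≤ ‖D‖ ^ 2 * ((b - a) ^ (2 * m - 1) / E ^ (2 * m - 1)) * α⁻¹ :=
              mul_le_mul_of_nonneg_right (mul_le_mul_of_nonneg_left e1 (sq_nonneg _))
                (inv_nonneg.2 hα.le)
          _ = C₂ * E := by
              rw [e2]
              have := (pow_pos hE (2 * m - 1)).ne'
              field_simp
              rfl
      have hg := mul_le_mul_of_nonneg_left (sum_norm_sq_adjoint_ofRows_le hL')
        (by positivity : 0 ≤ 2 / (n * α))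
      rw [hscale] at hg
      nlinarith [mul_pos hC₁ hE]

/-- The `L²` norm of `K x` is controlled by the sampled values and the penalty. -/
theorem exists_sampling_bound (hab : a < b) (hm : m ≠ 0)
    (hD : ∀ x, IsWeakDeriv a b m (K x) (D x)) (B : ℝ) :
    ∃ C : ℝ, 1 ≤ C ∧ ∀ (n : ℕ) (s : Fin n → ℝ) (α : ℝ), 0 < n → IsQuasiUniform a b B s →
      fillDist a b s ^ (2 * m) ≤ α → ∀ x,
        ‖K x‖ ^ 2 ≤ C * ((1 / (n : ℝ)) * ∑ i, contRep (K x) (s i) ^ 2 + α * ‖x‖ ^ 2) := by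
  have hm0 : (0 : ℝ) < m := by exact_mod_cast Nat.pos_of_ne_zero hm
  have hba : 0 < b - a := sub_pos.2 hab
  have hc := cellConst_pos m
  set A₁ := cellConst m * (8 * m * ((2 * |B| + 1) * (b - a)))
  set A₂ := cellConst m * ((8 * m) ^ (2 * m) * ‖D‖ ^ 2)
  set A₃ := ‖K‖ ^ 2 * (4 * m / (b - a)) ^ (2 * m)
  have hA₁ : 0 ≤ A₁ := by positivity
  have hA₂ : 0 ≤ A₂ := by positivity
  have hA₃ : 0 ≤ A₃ := by positivity
  refine ⟨A₁ + A₂ + A₃ + 1, by linarith, fun n s α hn hs hα x => ?_⟩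
  have hn0 : (0 : ℝ) < n := by exact_mod_cast hn
  have hh := fillDist_pos hab hn hs.mem_Icc
  set h := fillDist a b s with hhdef
  set Q := ∑ i, contRep (K x) (s i) ^ 2
  have hQ : 0 ≤ (1 / (n : ℝ)) * Q :=
    mul_nonneg (by positivity) (Finset.sum_nonneg fun i _ => sq_nonneg _)
  have hα0 : 0 ≤ α := (pow_nonneg hh.le _).trans hα
  have hX : 0 ≤ α * ‖x‖ ^ 2 := by positivity
  rcases le_or_gt (4 * m * h) (b - a) with h1 | h1
  · have h2 := norm_sq_le_sampling hab hm (hD x) hn hs.mem_Icc h1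
    -- Quasi-uniformity turns the weight h into 1/n. The summand 1 covers n = 1, where there are no
    -- gaps to compare and 4mh ≤ b − a is used instead.
    have h3 : h ≤ (2 * |B| + 1) * (b - a) * (1 / n) := by
      rw [mul_one_div, le_div_iff₀ hn0]
      rcases Nat.lt_or_ge n 2 with hlt | hge
      · have : n = 1 := by omega
        rw [this, Nat.cast_one, mul_one]
        have hm1 : (1 : ℝ) ≤ m := by exact_mod_cast Nat.one_le_iff_ne_zero.2 hm
        have : 0 ≤ 2 * |B| * (b - a) := by positivity
        nlinarith
      · have := hs.fillDist_mul_le hab hge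
        linarith
    have h4 : 8 * m * h * Q ≤ 8 * m * ((2 * |B| + 1) * (b - a)) * (1 / n * Q) := by
      have := mul_le_mul_of_nonneg_right h3 (Finset.sum_nonneg fun i _ => sq_nonneg _ : 0 ≤ Q)
      have := mul_le_mul_of_nonneg_left this (by positivity : (0 : ℝ) ≤ 8 * m)
      linarith
    have h5 : (8 * m * h) ^ (2 * m) * ‖D x‖ ^ 2 ≤
        (8 * m) ^ (2 * m) * ‖D‖ ^ 2 * (α * ‖x‖ ^ 2) := by
      have e1 := pow_le_pow_left₀ (norm_nonneg _) (D.le_opNorm x) 2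
      rw [mul_pow] at e1
      rw [mul_pow (8 * (m : ℝ))]
      calc (8 * (m : ℝ)) ^ (2 * m) * h ^ (2 * m) * ‖D x‖ ^ 2
          ≤ (8 * (m : ℝ)) ^ (2 * m) * α * (‖D‖ ^ 2 * ‖x‖ ^ 2) := by gcongr
        _ = _ := by ring
    have h6 := mul_le_mul_of_nonneg_left (add_le_add h4 h5) hc.le
    have h7 : A₁ * (1 / n * Q) + A₂ * (α * ‖x‖ ^ 2) ≤
        (A₁ + A₂ + A₃ + 1) * (1 / n * Q + α * ‖x‖ ^ 2) := by nlinarith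
    refine (h2.trans h6).trans (le_trans (le_of_eq ?_) h7)
    simp only [A₁, A₂]
    ring
  -- Here the points are too sparse for interpolation, but α ≥ h^{2m} is bounded below, so ‖Kx‖ ≤
  -- ‖K‖ ‖x‖ is enough.
  · have e1 := pow_le_pow_left₀ (norm_nonneg _) (K.le_opNorm x) 2
    rw [mul_pow] at e1
    have e2 : 1 ≤ (4 * m / (b - a)) ^ (2 * m) * α := by
      calc (1 : ℝ) ≤ (4 * m / (b - a) * h) ^ (2 * m) := by
            refine one_le_pow₀ ?_
            rw [div_mul_eq_mul_div, one_le_div hba]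
            exact h1.le
        _ ≤ _ := by
            rw [mul_pow]
            gcongr
    have e3 : ‖K‖ ^ 2 * ‖x‖ ^ 2 ≤ A₃ * (α * ‖x‖ ^ 2) := by
      have := mul_le_mul_of_nonneg_left e2 (by positivity : 0 ≤ ‖K‖ ^ 2 * ‖x‖ ^ 2)
      simp only [A₃]
      linarith
    nlinarith

end Sobolev

/-! ### The regularized solution and the parameter choice -/

section Regularized

variable {a b : ℝ} {K : L2 a b →L[ℝ] L2 a b} {n : ℕ} {s : Fin n → ℝ}

theorem tikhonov_eq {T : L2 a b →L[ℝ] EuclideanSpace ℝ (Fin n)} (hn : 0 < n)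
    (hT : ∀ x i, T x i = contRep (K x) (s i)) (w : Fin n → ℝ) (α : ℝ) (x : L2 a b) :
    tikhonov K s w α x =
      (1 / (n : ℝ)) * (‖T x - WithLp.toLp 2 w‖ ^ 2 + n * α * ‖x‖ ^ 2) := by
  have hn0 : (n : ℝ) ≠ 0 := by exact_mod_cast hn.ne'
  rw [tikhonov, EuclideanSpace.real_norm_sq_eq, mul_add]
  simp only [PiLp.sub_apply, hT]
  congr 1
  field_simp

/-- The solution of the normal equation is the only minimizer, so the choice made in `regSol` must
pick it. -/
theorem regSol_eq {T : L2 a b →L[ℝ] EuclideanSpace ℝ (Fin n)} (hn : 0 < n)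
    (hT : ∀ x i, T x i = contRep (K x) (s i)) {α : ℝ} (hα : 0 < α) {w : Fin n → ℝ} {x : L2 a b}
    (hx : T.adjoint (T x - WithLp.toLp 2 w) + (n * α) • x = 0) : regSol K s w α = x := by
  have hn0 : (0 : ℝ) < n := by exact_mod_cast hn
  have hmin : ∀ z, tikhonov K s w α x ≤ tikhonov K s w α z := by
    intro z
    rw [tikhonov_eq hn hT, tikhonov_eq hn hT]
    refine mul_le_mul_of_nonneg_left ?_ (by positivity)
    rw [ridge_functional_eq T hx z]
    have : 0 ≤ ‖T (z - x)‖ ^ 2 + n * α * ‖z - x‖ ^ 2 := by positivity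
    linarith
  have hreg : ∀ z, tikhonov K s w α (regSol K s w α) ≤ tikhonov K s w α z :=
    Classical.epsilon_spec (p := fun x => ∀ z, tikhonov K s w α x ≤ tikhonov K s w α z) ⟨x, hmin⟩
  refine ridge_minimizer_unique T (β := n * α) (by positivity) hx fun z => ?_
  have := hreg z
  rw [tikhonov_eq hn hT, tikhonov_eq hn hT] at this
  exact le_of_mul_le_mul_left this (by positivity)

theorem IsBestApproxSol.map_eq {y x : L2 a b} (h : IsBestApproxSol K y x) (hy : ∃ z, K z = y) :
    K x = y := by
  obtain ⟨z, hz⟩ := hy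
  have := h.1 z
  rw [hz, sub_self, norm_zero] at this
  exact sub_eq_zero.1 (norm_eq_zero.1 (le_antisymm this (norm_nonneg _)))

/-- The square of the lower half of the rule: variance is dominated by bias. -/
theorem sq_div_le_of_parameter_choice {m : ℕ} (hm : m ≠ 0) {c₁ σ X α : ℝ} (hc₁ : 0 < c₁)
    (hσ : 0 < σ) (hX : 0 < X) (hα : 0 < α) (hn : 0 < n)
    (h : c₁ * (σ * (n : ℝ) ^ (-(1 / 2) : ℝ) * X⁻¹) ≤ α ^ (1 / 2 + 1 / (4 * (m : ℝ)))) :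
    σ ^ 2 / n * α ^ (-(1 / (2 * m)) : ℝ) ≤ α * X ^ 2 / c₁ ^ 2 := by
  have hn0 : (0 : ℝ) < n := by exact_mod_cast hn
  have hm0 : (m : ℝ) ≠ 0 := by exact_mod_cast hm
  have h2 := pow_le_pow_left₀ (by positivity) h 2
  have e1 : ((n : ℝ) ^ (-(1 / 2) : ℝ)) ^ 2 = (n : ℝ)⁻¹ := by
    rw [← Real.rpow_natCast, ← Real.rpow_mul hn0.le, ← Real.rpow_neg_one]
    norm_num
  have e2 : (α ^ (1 / 2 + 1 / (4 * (m : ℝ)))) ^ 2 = α * α ^ (1 / (2 * m) : ℝ) := by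
    rw [← Real.rpow_natCast, ← Real.rpow_mul hα.le]
    nth_rewrite 2 [← Real.rpow_one α]
    rw [← Real.rpow_add hα]
    congr 1
    push_cast
    field_simp
    ring
  have hE : 0 < α ^ (1 / (2 * m) : ℝ) := Real.rpow_pos_of_pos hα _
  rw [mul_pow, mul_pow, mul_pow, e1, e2] at h2
  rw [Real.rpow_neg hα.le, ← div_eq_mul_inv, div_le_iff₀ hE, div_mul_eq_mul_div,
    le_div_iff₀ (by positivity)]
  have h3 := mul_le_mul_of_nonneg_right h2 (sq_nonneg X)
  have h4 : c₁ ^ 2 * (σ ^ 2 * (n : ℝ)⁻¹ * X⁻¹ ^ 2) * X ^ 2 = σ ^ 2 / n * c₁ ^ 2 := by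
    field_simp
  rw [h4] at h3
  linarith

/-- The power 2m/(1 + 2m) turns the exponent 1/2 + 1/(4m) of α into 1/2. -/
theorem sqrt_mul_sq_le_of_parameter_choice {m : ℕ} (hm : m ≠ 0) {c₂ σ X α : ℝ}
    (hσ : 0 < σ) (hX : 0 < X) (hα : 0 < α) (hn : 0 < n)
    (h : α ^ (1 / 2 + 1 / (4 * (m : ℝ))) ≤ c₂ * (σ * (n : ℝ) ^ (-(1 / 2) : ℝ) * X⁻¹)) :
    α ^ (1 / 2 : ℝ) * X ^ 2 ≤ |c₂| ^ (2 * (m : ℝ) / (1 + 2 * m)) *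
      ((σ * (n : ℝ) ^ (-(1 / 2) : ℝ)) ^ (2 * (m : ℝ) / (1 + 2 * (m : ℝ))) *
        X ^ ((2 + 2 * (m : ℝ)) / (1 + 2 * (m : ℝ)))) := by
  have hn0 : (0 : ℝ) < n := by exact_mod_cast hn
  have hm0 : (0 : ℝ) < m := by exact_mod_cast Nat.pos_of_ne_zero hm
  set τ := σ * (n : ℝ) ^ (-(1 / 2) : ℝ)
  have hτ : 0 < τ := by positivity
  set θ := 2 * (m : ℝ) / (1 + 2 * m)
  have hθ : 0 ≤ θ := by positivity
  have h1 : α ^ (1 / 2 + 1 / (4 * (m : ℝ))) ≤ |c₂| * (τ * X⁻¹) :=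
    h.trans (mul_le_mul_of_nonneg_right (le_abs_self _) (by positivity))
  have h2 := Real.rpow_le_rpow (by positivity) h1 hθ
  have e1 : (α ^ (1 / 2 + 1 / (4 * (m : ℝ)))) ^ θ = α ^ (1 / 2 : ℝ) := by
    rw [← Real.rpow_mul hα.le]
    congr 1
    simp only [θ]
    field_simp
    ring
  rw [e1, Real.mul_rpow (abs_nonneg _) (by positivity), Real.mul_rpow hτ.le (by positivity)] at h2
  refine (mul_le_mul_of_nonneg_right h2 (sq_nonneg X)).trans_eq ?_
  have e2 : X⁻¹ ^ θ * X ^ 2 = X ^ ((2 + 2 * (m : ℝ)) / (1 + 2 * (m : ℝ))) := by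
    rw [Real.inv_rpow hX.le, ← Real.rpow_neg hX.le, ← Real.rpow_natCast, ← Real.rpow_add hX]
    congr 1
    simp only [θ]
    push_cast
    field_simp
    ring
  rw [← e2]
  ring

/-- Raised to the power 1/2 + 1/(4m), the claim compares h^{m+1/2} = O(n^{-m-1/2}) with κ n^{-1/2},
and the former decays faster. -/
theorem exists_fillDist_pow_le (hab : a < b) (B : ℝ) {m : ℕ} (hm : m ≠ 0) {κ : ℝ} (hκ : 0 < κ) :
    ∃ N : ℕ, ∀ (n : ℕ) (s : Fin n → ℝ) (α : ℝ), N ≤ n → IsQuasiUniform a b B s → 0 < α →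
      κ * (n : ℝ) ^ (-(1 / 2) : ℝ) ≤ α ^ (1 / 2 + 1 / (4 * (m : ℝ))) →
      fillDist a b s ^ (2 * m) ≤ α := by
  have hm0 : (0 : ℝ) < m := by exact_mod_cast Nat.pos_of_ne_zero hm
  set A := 2 * |B| * (b - a)
  have hA : 0 ≤ A := mul_nonneg (by positivity) (sub_nonneg.2 hab.le)
  refine ⟨max 2 ⌈A ^ m * A ^ (1 / 2 : ℝ) / κ⌉₊, fun n s α hn hs hα h => ?_⟩
  have hn2 : 2 ≤ n := (le_max_left _ _).trans hn
  have hn0 : (0 : ℝ) < n := by exact_mod_cast (by omega : 0 < n)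
  have hn1 : (1 : ℝ) ≤ n := by exact_mod_cast (by omega : 1 ≤ n)
  have hnA : A ^ m * A ^ (1 / 2 : ℝ) ≤ κ * n ^ m := by
    have h1 : A ^ m * A ^ (1 / 2 : ℝ) / κ ≤ n :=
      (Nat.le_ceil _).trans (by exact_mod_cast (le_max_right _ _).trans hn)
    rw [div_le_iff₀ hκ] at h1
    have h2 : (n : ℝ) ≤ n ^ m := le_self_pow₀ hn1 hm
    nlinarith
  have hh := fillDist_pos hab (by omega) hs.mem_Icc
  have hhA : fillDist a b s ≤ A / n := by
    rw [le_div_iff₀ hn0]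
    exact hs.fillDist_mul_le hab hn2
  set η := fillDist a b s
  have hp : (0 : ℝ) < 1 / 2 + 1 / (4 * (m : ℝ)) := by positivity
  rw [← Real.rpow_le_rpow_iff (by positivity) hα.le hp]
  refine le_trans ?_ h
  have e1 : (η ^ (2 * m)) ^ (1 / 2 + 1 / (4 * (m : ℝ))) = η ^ m * η ^ (1 / 2 : ℝ) := by
    rw [← Real.rpow_natCast, ← Real.rpow_natCast, ← Real.rpow_mul hh.le, ← Real.rpow_add hh]
    congr 1
    push_cast
    field_simp
    ring
  have e2 : (A / n) ^ m * (A / n) ^ (1 / 2 : ℝ) =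
      A ^ m * A ^ (1 / 2 : ℝ) / n ^ m * (n : ℝ) ^ (-(1 / 2) : ℝ) := by
    rw [div_pow, Real.div_rpow hA hn0.le, Real.rpow_neg hn0.le]
    ring
  rw [e1]
  calc η ^ m * η ^ (1 / 2 : ℝ) ≤ (A / n) ^ m * (A / n) ^ (1 / 2 : ℝ) := by gcongr
    _ ≤ κ * (n : ℝ) ^ (-(1 / 2) : ℝ) := by
        rw [e2]
        refine mul_le_mul_of_nonneg_right ?_ (by positivity)
        rw [div_le_iff₀ (by positivity)]
        exact hnA

/-- The square of the dual norm is controlled by the energy of the error. -/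
theorem normWDual_sq_le_energy {ι : Type*} {sv : ι → ℝ} {φ ψ : ι → L2 a b}
    (h : IsSingularSystem K sv φ ψ) {C α E : ℝ} (hC : 1 ≤ C) (hα : 0 < α) (hE : 0 ≤ E) {d : L2 a b}
    (h1 : ‖K d‖ ^ 2 ≤ C * (E + α * ‖d‖ ^ 2)) :
    normWDual K sv φ d ^ 2 ≤ C * α ^ (-(1 / 2) : ℝ) * (E + α * ‖d‖ ^ 2) := by
  refine (normWDual_sq_le h d).trans ?_
  have hr : 0 < Real.sqrt α := Real.sqrt_pos.2 hα
  have hr2 := Real.sq_sqrt hα.le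
  rw [Real.rpow_neg hα.le, ← Real.sqrt_eq_rpow, mul_assoc, ← div_eq_inv_mul, ← mul_div_assoc,
    le_div_iff₀ hr]
  set r := Real.sqrt α
  -- Young's inequality with weight √α; C ≥ 1 then absorbs the second term.
  have h2 : 2 * (‖K d‖ * ‖d‖ * r) ≤ ‖K d‖ ^ 2 + α * ‖d‖ ^ 2 := by
    rw [← hr2]
    nlinarith [sq_nonneg (‖K d‖ - r * ‖d‖)]
  have h3 : 0 ≤ α * ‖d‖ ^ 2 := by positivity
  nlinarith [mul_nonneg (sub_nonneg.2 hC) (add_nonneg hE h3)]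

end Regularized

end Fredholm

/-! ### The convergence rate -/

theorem mainTheorem6
    (a b : ℝ) (hab : a < b)
    (k : ℝ × ℝ → ℝ)
    (hk : MemLp k 2 ((Fredholm.intervalVol a b).prod (Fredholm.intervalVol a b)))
    (m : ℕ) (hm : 0 < m)
    (hrange : ∀ x : Fredholm.L2 a b, Fredholm.MemSobolev a b m (Fredholm.integralOp a b k hk x))
    {ι : Type*} (sv : ι → ℝ) (φ ψ : ι → Fredholm.L2 a b)
    (hsing : Fredholm.IsSingularSystem (Fredholm.integralOp a b k hk) sv φ ψ)
    (B c₁ c₂ : ℝ) (hc₁ : 0 < c₁) :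
    ∃ C : ℝ, 0 < C ∧
      ∀ (σ : ℝ) (y xdag : Fredholm.L2 a b), 0 < σ →
        (∃ x, Fredholm.integralOp a b k hk x = y) →
        Fredholm.IsBestApproxSol (Fredholm.integralOp a b k hk) y xdag → xdag ≠ 0 →
        ∃ N : ℕ, ∀ (n : ℕ) (s : Fin n → ℝ) (α : ℝ), 0 < n →
          Fredholm.IsQuasiUniform a b B s → 0 < α →
          c₁ * (σ * (n : ℝ) ^ (-(1 / 2) : ℝ) * ‖xdag‖⁻¹) ≤
            α ^ (1 / 2 + 1 / (4 * (m : ℝ))) →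
          α ^ (1 / 2 + 1 / (4 * (m : ℝ))) ≤
            c₂ * (σ * (n : ℝ) ^ (-(1 / 2) : ℝ) * ‖xdag‖⁻¹) →
          (Fredholm.fillDist a b s ^ (2 * m) ≤ α ∨ N ≤ n) →
          ∀ (Ω : Type*) [MeasurableSpace Ω] (P : Measure Ω) [IsProbabilityMeasure P]
            (e : Fin n → Ω → ℝ),
            (∀ i, MemLp (e i) 2 P) → iIndepFun e P →
            (∀ i, ∫ ω, e i ω ∂P = 0) → (∀ i, variance (e i) P ≤ σ ^ 2) →
            Integrable (fun ω => Fredholm.normWDual (Fredholm.integralOp a b k hk) sv φ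
                (Fredholm.regSol (Fredholm.integralOp a b k hk) s
                  (fun i => Fredholm.contRep y (s i) + e i ω) α - xdag) ^ 2) P ∧
              ∫ ω, Fredholm.normWDual (Fredholm.integralOp a b k hk) sv φ
                (Fredholm.regSol (Fredholm.integralOp a b k hk) s
                  (fun i => Fredholm.contRep y (s i) + e i ω) α - xdag) ^ 2 ∂P ≤
                C * ((σ * (n : ℝ) ^ (-(1 / 2) : ℝ)) ^ (2 * (m : ℝ) / (1 + 2 * (m : ℝ))) *
                  ‖xdag‖ ^ ((2 + 2 * (m : ℝ)) / (1 + 2 * (m : ℝ)))) := by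
  have hm' : m ≠ 0 := hm.ne'
  set K := Fredholm.integralOp a b k hk
  obtain ⟨D, hD⟩ := Fredholm.exists_weakDeriv_clm K fun x => hrange x m le_rfl
  obtain ⟨C₁, hC₁, hdim⟩ := Fredholm.exists_effective_dimension_bound hab hm' hD
  obtain ⟨C₂, hC₂, hsamp⟩ := Fredholm.exists_sampling_bound hab hm' hD B
  have hC₂0 : 0 < C₂ := zero_lt_one.trans_le hC₂
  -- The factors come from the sampling inequality, from variance plus bias, and from the rate; the
  -- added 1 keeps the constant positive even if c₂ = 0.
  refine ⟨C₂ * (C₁ / c₁ ^ 2 + 2) * |c₂| ^ (2 * (m : ℝ) / (1 + 2 * m)) + 1, by positivity,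
    fun σ y xdag hσ hy hbest hx0 => ?_⟩
  have hX : 0 < ‖xdag‖ := norm_pos_iff.2 hx0
  have hKx := hbest.map_eq hy
  obtain ⟨N, hN⟩ := Fredholm.exists_fillDist_pow_le hab B hm'
    (by positivity : 0 < c₁ * (σ * ‖xdag‖⁻¹))
  refine ⟨N, fun n s α hn hs hα hα1 hα2 hor Ω _ P hP e he hind h0 hvar => ?_⟩
  have hn0 : (0 : ℝ) < n := by exact_mod_cast hn
  have hβ : 0 < n * α := by positivity
  have hfill : Fredholm.fillDist a b s ^ (2 * m) ≤ α := by
    rcases hor with h | h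
    · exact h
    · exact hN n s α h hs hα (le_trans (le_of_eq (by ring)) hα1)
  obtain ⟨T, S, F, hT, hTS, hbound⟩ := hdim n s α hn hs.mem_Icc hα
  obtain ⟨Z, hZ1, hZ2, hZ3⟩ :=
    Fredholm.exists_ridge_majorant hβ he hP hind h0 hvar T S F hTS xdag
  -- The regularized solution is a continuous linear function of the data, so the error depends
  -- continuously on the noise vector and is measurable.
  obtain ⟨R, hR⟩ := Fredholm.exists_ridge T hβ
  have hdata : ∀ ω, (WithLp.toLp 2 fun i => Fredholm.contRep y (s i) + e i ω) =
      T xdag + WithLp.toLp 2 fun i => e i ω := by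
    intro ω
    ext i
    simp [hT, hKx]
  have hreg : ∀ ω, Fredholm.regSol K s (fun i => Fredholm.contRep y (s i) + e i ω) α =
      R (T xdag + WithLp.toLp 2 fun i => e i ω) := by
    intro ω
    refine Fredholm.regSol_eq hn hT hα ?_
    rw [hdata]
    exact hR _
  simp_rw [hreg]
  set q : Ω → ℝ := fun ω => Fredholm.normWDual K sv φ
    (R (T xdag + WithLp.toLp 2 fun i => e i ω) - xdag) ^ 2
  have hle : ∀ ω, q ω ≤ C₂ * α ^ (-(1 / 2) : ℝ) * (1 / n) * Z ω := by
    intro ω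
    set d := R (T xdag + WithLp.toLp 2 fun i => e i ω) - xdag
    have hTd : ∑ i, Fredholm.contRep (K d) (s i) ^ 2 = ‖T d‖ ^ 2 := by
      rw [EuclideanSpace.real_norm_sq_eq]
      simp only [hT]
    have e1 := hsamp n s α hn hs hfill d
    rw [hTd] at e1
    refine (Fredholm.normWDual_sq_le_energy hsing hC₂ hα (by positivity) e1).trans ?_
    rw [mul_assoc _ (1 / (n : ℝ))]
    refine mul_le_mul_of_nonneg_left ?_ (by positivity)
    have e2 := mul_le_mul_of_nonneg_left (hZ3 ω _ (hR _)) (by positivity : 0 ≤ 1 / (n : ℝ))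
    refine le_trans (le_of_eq ?_) e2
    field_simp
    rfl
  have hmeas : AEStronglyMeasurable q P := by
    have hcont : Continuous fun w : Fin n → ℝ => Fredholm.normWDual K sv φ
        (R (T xdag + WithLp.toLp 2 w) - xdag) ^ 2 :=
      ((Fredholm.continuous_normWDual hsing).comp ((R.continuous.comp (continuous_const.add
        (PiLp.continuous_toLp 2 _))).sub continuous_const)).pow 2
    refine hcont.comp_aestronglyMeasurable (f := fun ω i => e i ω) ?_
    exact (aemeasurable_pi_lambda _ fun i => (he i).1.aemeasurable).aestronglyMeasurable
  have hint : Integrable q P := by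
    refine (hZ1.const_mul (C₂ * α ^ (-(1 / 2) : ℝ) * (1 / n))).mono' hmeas
      (Filter.Eventually.of_forall fun ω => ?_)
    rw [Real.norm_eq_abs, abs_of_nonneg (sq_nonneg _)]
    exact hle ω
  refine ⟨hint, ?_⟩
  have hrate := Fredholm.sqrt_mul_sq_le_of_parameter_choice hm' hσ hX hα hn hα2
  have hvarb := Fredholm.sq_div_le_of_parameter_choice hm' hc₁ hσ hX hα hn hα1
  set ρ := (σ * (n : ℝ) ^ (-(1 / 2) : ℝ)) ^ (2 * (m : ℝ) / (1 + 2 * (m : ℝ))) *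
    ‖xdag‖ ^ ((2 + 2 * (m : ℝ)) / (1 + 2 * (m : ℝ)))
  have hρ : 0 ≤ ρ := by positivity
  have hZ4 : 1 / n * ∫ ω, Z ω ∂P ≤ (C₁ / c₁ ^ 2 + 2) * (α * ‖xdag‖ ^ 2) := by
    have e1 := hZ2.trans (add_le_add_left
      (mul_le_mul_of_nonneg_left hbound (sq_nonneg σ)) _)
    have e2 := mul_le_mul_of_nonneg_left e1 (by positivity : 0 ≤ 1 / (n : ℝ))
    have e3 := mul_le_mul_of_nonneg_left hvarb hC₁.le
    refine e2.trans ?_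
    calc 1 / (n : ℝ) * (σ ^ 2 * (C₁ * α ^ (-(1 / (2 * m)) : ℝ)) + 2 * (n * α) * ‖xdag‖ ^ 2)
        = C₁ * (σ ^ 2 / n * α ^ (-(1 / (2 * m)) : ℝ)) + 2 * (α * ‖xdag‖ ^ 2) := by
          field_simp
      _ ≤ C₁ * (α * ‖xdag‖ ^ 2 / c₁ ^ 2) + 2 * (α * ‖xdag‖ ^ 2) := by linarith
      _ = _ := by ring
  have hαα : α ^ (-(1 / 2) : ℝ) * α = α ^ (1 / 2 : ℝ) := by
    nth_rewrite 2 [← Real.rpow_one α]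
    rw [← Real.rpow_add hα]
    norm_num
  calc ∫ ω, q ω ∂P ≤ ∫ ω, C₂ * α ^ (-(1 / 2) : ℝ) * (1 / n) * Z ω ∂P :=
        integral_mono hint (hZ1.const_mul _) hle
    _ = C₂ * α ^ (-(1 / 2) : ℝ) * (1 / n * ∫ ω, Z ω ∂P) := by
        rw [integral_const_mul, mul_assoc _ (1 / (n : ℝ))]
    _ ≤ C₂ * α ^ (-(1 / 2) : ℝ) * ((C₁ / c₁ ^ 2 + 2) * (α * ‖xdag‖ ^ 2)) :=
        mul_le_mul_of_nonneg_left hZ4 (by positivity)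
    _ = C₂ * (C₁ / c₁ ^ 2 + 2) * (α ^ (1 / 2 : ℝ) * ‖xdag‖ ^ 2) := by
        rw [← hαα]
        ring
    _ ≤ C₂ * (C₁ / c₁ ^ 2 + 2) * (|c₂| ^ (2 * (m : ℝ) / (1 + 2 * m)) * ρ) :=
        mul_le_mul_of_nonneg_left hrate (by positivity)
    _ ≤ _ := by
        rw [← mul_assoc]
        exact mul_le_mul_of_nonneg_right (le_add_of_nonneg_right zero_le_one) hρ
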